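/- Let $\mathcal I_n$ be the set of 0-1 sequences of length $n$ and $\mathcal I=\bigcup_{n\ge 0}\mathcal I_n$. For $I,J\in\mathcal I$ write $J\subset I$ if $J$ is a continuation of $I$ (possibly $J=I$), and $I\cap J=\emptyset$ if neither is a continuation of the other. A distance function is a map $\rho:\mathcal I\times\mathcal I\to[0,\infty)$ that is symmetric, with $\rho(I,J)=0$ if $I\subset J$ or $J\subset I$, and with $\rho(I,K)\le\rho(J,K)$ whenever $J\subset I$. Fix an integer $d\ge 1$. Write $B(S,s)$ for the open $s$-neighbourhood of $S\subset\mathbb R^d$. **Embedding problem.** The answer for $\rho$ is positive if there are nonempty bounded sets $A_I\subset\mathbb R^d$ $(I\in\mathcal I)$ such that $A_I\subset A_J$ if $I\subset J$; $A_I\cap A_J=\emptyset$ if $I\cap J=\emptyset$; and $\mathrm{dist}(A_I,A_J)\ge\rho(I,J)$ if $I\cap J=\emptyset$. **The sequence $r_n$.** For $J\subset I\neq\emptyset$ put $\rho_{J,I}=\inf\{\rho(J,K):K\cap I=\emptyset\}$ and $\rho_I=\sup_{J\subset I}\rho_{J,I}$. We assume that for $n\ge1$ and $I\in\mathcal I_n$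 the number $r_n:=\rho_I$ is finite and depends only on $n$. **Bounded growth.** $\rho$ has bounded growth if the following holds: if the answer to the embedding problem is positive, then there are integers $C\ge 1$, $q\ge 0$ and positive integers $k_{n,m}$ $(m\ge n\ge1)$ with $c\,r_n\le k_{n,m}r_m$ for some constant $c>0$, with $$\sup_{n\ge1}\sum_{m\ge n}2^{(m-n)/d}k_{n,m}^{-1}<\infty,\qquad 2^{(m-n)/d}k_{n,m}^{-1}<(4C)^{-1}\ \text{ if } m-n\text{ is large enough},$$ and there are bounded sets $C_I\subset\mathbb R^d$ (for $I\in\mathcal I_n$, $n\ge1$) and bounded sets $E_{I,j}=E_{I,j}^{(m)}\subset\mathbb R^d$ (for $I\in\mathcal I_n$, $m\ge n\ge 1$, $j\ge0$), with annuli $D_{I,j}=D_{I,j}^{(m)}=B(E_{I,j}^{(m)},r_m)\setminus E_{I,j}^{(m)}$, such that $C_J\subset C_I$ if $J\subset I$, $C_I\cap C_J=\emptyset$ if $I\cap J=\emptyset$, and, with constants independent of $n,m,k,I,J,j,x$ and all indices $n,m,k\ge1$: 1. for each $I\in\mathcal I_n$ and $m\ge n$ there are at most constantly many $I'\in\mathcal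 I_m$ with $I'\cap I=\emptyset$ and $B(C_I,r_m)\cap B(C_{I'},r_m)\ne\emptyset$; 2. for some constant $c'>0$, every $C_I$ with $I\in\mathcal I_n$ contains a ball of radius $c'r_n$; 3. $C_I\subset E_{I,j}^{(m)}$ for all $I\in\mathcal I_n$, $m\ge n$ and $j$; 4. for $m\ge n$ and $J\in\mathcal I_m$ there are at most $C$ pairs $(I,j)$ with $I\in\mathcal I_n$, $j<k_{n,m}$ and $D^{(m)}_{I,j}\cap C_J\neq\emptyset$; 5. for some constant $c''$, for $m>n$ and every $x\in\mathbb R^d$, the number of pairs $(I,j)$ with $I\in\mathcal I_n$, $j<k_{n,m}$, $x\in D^{(m)}_{I,j}$, multiplied by $r_n$, is at most $c''k_{n,m}r_m$; 6. for every $k$ and $I\in\mathcal I_k$ there are nonempty sets $\mathcal I_n'\subset\{I'\in\mathcal I_n:I'\subset I\}$ $(n\ge k+q)$ such that for all $n\ge k+q$, $m\ge n+q$, $I'\in\mathcal I_n'$ and $j<k_{n,m}$: $D^{(m)}_{I',j}\subset C_I$, and if $D^{(m)}_{I',j}\cap C_{I''}\ne\emptyset$ with $I''\in\mathcal I_m$,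 then $I''\in\mathcal I_m'$. **Theorem.** Suppose that the distance function $\rho$ has bounded growth. If the answer to the embedding problem is positive, then $\sum_{n\ge1}2^{n/d}r_n<\infty$. -/

import Mathlib

open Set Metric

namespace BinaryEmbedding

/-- Finite 0-1 sequences; `I.length = n` means that `I` belongs to the `n`-th level. -/
abbrev Word : Type := List Bool

/-- `J ⊂ I`: the sequence `J` is a continuation of the sequence `I` (possibly `J = I`). -/
def Inside (J I : Word) : Prop := I <+: J

/-- `I ∩ J = ∅`: neither sequence is a continuation of the other. -/
def Disj (I J : Word) : Prop := ¬ Inside I J ∧ ¬ Inside J I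

/-- Distance functions on finite 0-1 sequences (no triangle inequality). -/
structure IsDistanceFunction (ρ : Word → Word → ℝ) : Prop where
  zero : ∀ I J, Inside I J ∨ Inside J I → ρ I J = 0
  nonneg : ∀ I J, 0 ≤ ρ I J
  symm : ∀ I J, ρ I J = ρ J I
  mono : ∀ I J K, Inside J I → ρ I K ≤ ρ J K

/-- There are nonempty bounded sets `A I ⊂ ℝ^d`, nested along continuations, disjoint for
disjoint sequences, with `dist (A I, A J) ≥ ρ I J` for disjoint `I`, `J`. -/
def PositiveAnswer (d : ℕ) (ρ : Word → Word → ℝ) : Prop :=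
  ∃ A : Word → Set (EuclideanSpace ℝ (Fin d)),
    (∀ I, (A I).Nonempty ∧ Bornology.IsBounded (A I)) ∧
    (∀ I J, Inside I J → A I ⊆ A J) ∧
    (∀ I J, Disj I J → Disjoint (A I) (A J)) ∧
    (∀ I J, Disj I J → ∀ x ∈ A I, ∀ y ∈ A J, ρ I J ≤ dist x y)

/-- `ρ_{J,I} = inf {ρ(J,K) : K ∩ I = ∅}`. The infimum is over a nonempty set as soon as `I` is not
the empty sequence, and it is only used for such `I`. -/
noncomputable def rhoRel (ρ : Word → Word → ℝ) (J I : Word) : ℝ :=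
  sInf {t : ℝ | ∃ K, Disj K I ∧ t = ρ J K}

/-- For every `n ≥ 1` and every `I` of length `n`, `r n = ρ_I = sup {ρ_{J,I} : J ⊂ I}`; in
particular the supremum is finite and depends only on the length of `I`. -/
def IsScaleSequence (ρ : Word → Word → ℝ) (r : ℕ → ℝ) : Prop :=
  ∀ n, 1 ≤ n → ∀ I : Word, I.length = n →
    IsLUB {t : ℝ | ∃ J, Inside J I ∧ t = rhoRel ρ J I} (r n)

/-- The annulus `B(S, s) \ S` of width `s` around `S`, with `B(S, s)` the open neighbourhood. -/
def annulus {d : ℕ} (s : ℝ) (S : Set (EuclideanSpace ℝ (Fin d))) :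
    Set (EuclideanSpace ℝ (Fin d)) :=
  thickening s S \ S

/-- The assumptions on the numbers `k n m` (`m ≥ n ≥ 1`): they are positive,
`k n m ≳ r n / r m`, `sup_n ∑_{m ≥ n} 2^((m-n)/d) / k n m < ∞`, and
`2^((m-n)/d) / k n m < 1 / (4 C)` if `m - n` is large enough. -/
structure AdmissibleCounts (d : ℕ) (r : ℕ → ℝ) (C : ℕ) (k : ℕ → ℕ → ℕ) : Prop where
  pos : ∀ n m : ℕ, 1 ≤ n → n ≤ m → 0 < k n m
  lower : ∃ c : ℝ, 0 < c ∧ ∀ n m : ℕ, 1 ≤ n → n ≤ m → c * r n ≤ k n m * r m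
  sum : ∃ B : ℝ, ∀ n : ℕ, 1 ≤ n → ∀ M : ℕ,
    ∑ m ∈ Finset.Icc n M, (2 : ℝ) ^ (((m : ℝ) - n) / d) * (k n m : ℝ)⁻¹ ≤ B
  large : ∃ l : ℕ, ∀ n m : ℕ, 1 ≤ n → n + l ≤ m →
    (2 : ℝ) ^ (((m : ℝ) - n) / d) * (k n m : ℝ)⁻¹ < (4 * (C : ℝ))⁻¹

/-- Existence of sets `S I` (for `I` of length `n ≥ 1`) and `E I m j` (for `m ≥ n`, `j ≥ 0`), all
bounded, the `S I` nested along continuations and disjoint for disjoint sequences, with the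
properties listed below. The annulus of `E I m j` is `annulus (r m) (E I m j)`. -/
def HasAnnuliSystem (d : ℕ) (r : ℕ → ℝ) (C q : ℕ) (k : ℕ → ℕ → ℕ) : Prop :=
  ∃ (S : Word → Set (EuclideanSpace ℝ (Fin d)))
    (E : Word → ℕ → ℕ → Set (EuclideanSpace ℝ (Fin d))),
    -- the sets are bounded
    (∀ I : Word, 1 ≤ I.length → Bornology.IsBounded (S I)) ∧
    (∀ I : Word, 1 ≤ I.length → ∀ m, I.length ≤ m → ∀ j, Bornology.IsBounded (E I m j)) ∧
    -- the sets `S I` are nested and disjoint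
    (∀ I J : Word, 1 ≤ I.length → Inside J I → S J ⊆ S I) ∧
    (∀ I J : Word, 1 ≤ I.length → 1 ≤ J.length → Disj I J → Disjoint (S I) (S J)) ∧
    -- boundedly many sets of level `m` outside `I` come close to `S I`
    (∃ N : ℕ, ∀ I : Word, 1 ≤ I.length → ∀ m, I.length ≤ m →
      {I' : Word | I'.length = m ∧ Disj I' I ∧
        (thickening (r m) (S I) ∩ thickening (r m) (S I')).Nonempty}.encard ≤ N) ∧
    -- `S I` contains a ball of radius comparable to `r n`
    (∃ c : ℝ, 0 < c ∧ ∀ I : Word, 1 ≤ I.length → ∃ x, ball x (c * r I.length) ⊆ S I) ∧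
    -- `S I ⊂ E I m j`
    (∀ I : Word, 1 ≤ I.length → ∀ m, I.length ≤ m → ∀ j, S I ⊆ E I m j) ∧
    -- each `S J` of level `m` meets at most `C` of the annuli of level `n`
    (∀ n m : ℕ, 1 ≤ n → n ≤ m → ∀ J : Word, J.length = m →
      {p : Word × ℕ | p.1.length = n ∧ p.2 < k n m ∧
        (annulus (r m) (E p.1 m p.2) ∩ S J).Nonempty}.encard ≤ C) ∧
    -- each point lies in at most `≲ k n m * r m / r n` of the annuli of level `n`
    (∃ B : ℝ, ∀ n m : ℕ, 1 ≤ n → n < m → ∀ x : EuclideanSpace ℝ (Fin d),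
      ({p : Word × ℕ | p.1.length = n ∧ p.2 < k n m ∧
        x ∈ annulus (r m) (E p.1 m p.2)}.ncard : ℝ) * r n ≤ B * (k n m * r m)) ∧
    -- for each `I` there are nonempty families `F n` of level `n` sequences inside `I` whose
    -- annuli lie in `S I` and meet `S I''` of level `m` only for `I''` in `F m`
    (∀ I : Word, 1 ≤ I.length → ∃ F : ℕ → Set Word,
      (∀ n, I.length + q ≤ n →
        (F n).Nonempty ∧ ∀ I' ∈ F n, I'.length = n ∧ Inside I' I) ∧
      (∀ n m, I.length + q ≤ n → n + q ≤ m → ∀ I' ∈ F n, ∀ j < k n m,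
        annulus (r m) (E I' m j) ⊆ S I ∧
        ∀ I'' : Word, I''.length = m →
          (annulus (r m) (E I' m j) ∩ S I'').Nonempty → I'' ∈ F m))

/-- Bounded growth: a positive answer to the embedding problem implies that, for some `C`, `q` and
admissible `k`, a system of sets as above exists. -/
def BoundedGrowth (d : ℕ) (ρ : Word → Word → ℝ) (r : ℕ → ℝ) : Prop :=
  PositiveAnswer d ρ →
    ∃ (C q : ℕ) (k : ℕ → ℕ → ℕ), 0 < C ∧ AdmissibleCounts d r C k ∧ HasAnnuliSystem d r C q k

end BinaryEmbedding

/-! The proof plays volume against a relative perimeter. `perimeter S` is the limsup, as s → 0, of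
1/s times the least volume of a width-s annulus around a bounded superset of S. It is subadditive
and at least vol(S)^(1-1/d) (`perimeter_ge`). Peeling a wide annulus into thin layers gives
`perimeter_le_of_subset`: if S ⊆ E, the width-r annulus of E has volume of order r · perimeter S
outside Y, unless Y itself has comparable perimeter.

Fix a set S I of least volume at level k, and let A n be the total perimeter of the level-n family
inside it. Applying this inequality to all annuli of level n, with Y the union of the level-m sets
of the family that meet the annulus, gives `mul_sum_perimeter_le`: r n · A n is at most a multiple
of the volume of the gap (the part of S I outside level m) plus C · (r n / k n m) · A m. Write v n
for 2^n times the least volume at level n, y n = (v n)^(1/d), s n = 2^(n/d) · r n and H n = 2^k · r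
n · A n. Disjointness gives 2^k · vol(gap) ≤ v k - v m, hence H n ≤ 2B · (y k ^ d - y m ^ d) + e n m
· (s n / s m) · H m, with e n m = C · 2^((m-n)/d) / k n m. Moreover H is bounded from level k + q
on, and isoperimetry bounds H (k+q) below by a multiple of s (k+q) · y (k+q)^(d-1).

If the sum of s n diverged, some k would have y decreasing slowly from k on, compared with the
partial sums of s. The volume term would then be a small multiple of these sums, and a solution of
the recursion starting so large cannot stay bounded (`exists_forall_lt_of_recursion`). -/

namespace BinaryEmbedding

open MeasureTheory Filter Topology
open scoped ENNReal NNReal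

/-! ### Isoperimetric inequality for annuli -/

section Isoperimetric

/-- A line parallel to a coordinate axis through a point of a compact set `K` meets the annulus of
width `s` around `K` in a set of length at least `s`. -/
lemma ofReal_le_volume_line_annulus {d : ℕ} {K : Set (EuclideanSpace ℝ (Fin d))}
    (hK : IsCompact K) (s : ℝ) {x : Fin d → ℝ} (hx : WithLp.toLp 2 x ∈ K)
    (i : Fin d) :
    ENNReal.ofReal s ≤
      volume {t : ℝ | WithLp.toLp 2 (Function.update x i t) ∈ annulus s K} := by
  set φ : ℝ → EuclideanSpace ℝ (Fin d) := fun t => WithLp.toLp 2 (Function.update x i t) with hφ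
  have hiso : ∀ t u, dist (φ t) (φ u) = dist t u := by
    intro t u
    rw [EuclideanSpace.dist_eq, Finset.sum_eq_single i]
    · simp [hφ]
    · intro j _ hj
      simp [hφ, Function.update_of_ne hj]
    · simp
  have hI : Isometry φ := Isometry.of_dist_eq hiso
  have hT : IsCompact (φ ⁻¹' K) := hI.isClosedEmbedding.isCompact_preimage hK
  have hne : (φ ⁻¹' K).Nonempty := ⟨x i, by simpa [hφ] using hx⟩
  have hmem : sSup (φ ⁻¹' K) ∈ φ ⁻¹' K := hT.sSup_mem hne
  set t₀ := sSup (φ ⁻¹' K)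
  -- Past the last point t₀ of the line in `K`, points are outside `K` but, up to t₀ + s, within s
  -- of it.
  have hsub : Ioo t₀ (t₀ + s) ⊆ {t : ℝ | φ t ∈ annulus s K} := by
    intro t ht
    refine ⟨mem_thickening_iff.2 ⟨φ t₀, hmem, ?_⟩, fun h => ?_⟩
    · rw [hiso, Real.dist_eq, abs_of_pos (by linarith [ht.1])]
      linarith [ht.2]
    · exact absurd (le_csSup hT.bddAbove h) (not_le.2 ht.1)
  calc ENNReal.ofReal s = volume (Ioo t₀ (t₀ + s)) := by simp
    _ ≤ _ := measure_mono hsub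

lemma volume_eq_lintegral_toLp {d : ℕ} {G : Set (EuclideanSpace ℝ (Fin d))}
    (hG : MeasurableSet G) :
    volume G = ∫⁻ x : Fin d → ℝ, (WithLp.toLp 2 ⁻¹' G).indicator 1 x := by
  have hm : Measurable (WithLp.toLp 2 : (Fin d → ℝ) → EuclideanSpace ℝ (Fin d)) :=
    (PiLp.volume_preserving_toLp (Fin d)).measurable
  rw [lintegral_indicator_one (hm hG),
    (PiLp.volume_preserving_toLp (Fin d)).measure_preimage hG.nullMeasurableSet]

/-- A weak isoperimetric inequality for compact sets. -/
lemma volume_annulus_of_isCompact {d : ℕ} (hd : 1 ≤ d) {K : Set (EuclideanSpace ℝ (Fin d))}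
    (hK : IsCompact K) (hne : K.Nonempty) (s : ℝ) :
    ENNReal.ofReal s * volume K ^ (1 - 1 / (d : ℝ)) ≤ volume (annulus s K) := by
  have hG : MeasurableSet (annulus s K) :=
    isOpen_thickening.measurableSet.diff hK.isClosed.measurableSet
  have hm : Measurable (WithLp.toLp 2 : (Fin d → ℝ) → EuclideanSpace ℝ (Fin d)) :=
    (PiLp.volume_preserving_toLp (Fin d)).measurable
  have hline : ∀ x : Fin d → ℝ, WithLp.toLp 2 x ∈ K → ∀ i, ENNReal.ofReal s ≤
      ∫⁻ t : ℝ, (WithLp.toLp 2 ⁻¹' annulus s K).indicator (1 : (Fin d → ℝ) → ℝ≥0∞)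
        (Function.update x i t) := by
    intro x hx i
    have hmi : Measurable fun t : ℝ => Function.update x i t := measurable_update x
    have := ofReal_le_volume_line_annulus hK s hx i
    have hset : MeasurableSet {t : ℝ | WithLp.toLp 2 (Function.update x i t) ∈ annulus s K} :=
      (hm.comp hmi) hG
    rw [← lintegral_indicator_one hset] at this
    exact this
  -- The exponent d/(d-1) needs d > 1. For d = 1 the power of the volume is 1 and the space is a
  -- single line.
  rcases hd.eq_or_lt with rfl | hd2
  · obtain ⟨x, hx⟩ := hne
    have h1 := ofReal_le_volume_line_annulus hK s (x := x.ofLp) hx 0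
    have h2 : (fun t : ℝ => Function.update x.ofLp 0 t) =
        (MeasurableEquiv.funUnique (Fin 1) ℝ).symm := by
      funext t
      ext j
      fin_cases j
      simp [MeasurableEquiv.funUnique]
    have h3 : {t : ℝ | WithLp.toLp 2 (Function.update x.ofLp 0 t) ∈ annulus s K} =
        (MeasurableEquiv.funUnique (Fin 1) ℝ).symm ⁻¹' (WithLp.toLp 2 ⁻¹' annulus s K) := by
      rw [← h2]; rfl
    rw [h3, (volume_preserving_funUnique (Fin 1) ℝ).symm.measure_preimage
      (hm hG).nullMeasurableSet] at h1
    have h4 := (PiLp.volume_preserving_toLp (Fin 1)).measure_preimage hG.nullMeasurableSet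
    have h5 : ENNReal.ofReal s ≤ volume (annulus s K) := by
      rw [← h4]
      convert h1
    simpa using h5
  · have hdR : (1 : ℝ) < d := by exact_mod_cast hd2
    have hd1 : (0 : ℝ) < d - 1 := by linarith
    set p : ℝ := d / (d - 1) with hp
    have hp0 : 0 < p := by positivity
    have hconj : Real.HolderConjugate (Fintype.card (Fin d) : ℝ) p := by
      rw [Fintype.card_fin]
      exact Real.HolderConjugate.conjExponent hdR
    -- Grid-lines inequality behind Gagliardo–Nirenberg–Sobolev, for the indicator of the annulus.
    -- At points of `K` all d section lengths are at least s.
    have key := lintegral_prod_lintegral_pow_le (fun _ : Fin d => (volume : Measure ℝ)) hconj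
      (f := (WithLp.toLp 2 ⁻¹' annulus s K).indicator 1)
      (measurable_one.indicator (hm hG))
    rw [← volume_pi, ← volume_eq_lintegral_toLp hG] at key
    have hlow : ENNReal.ofReal s ^ p * volume K ≤ volume (annulus s K) ^ p := by
      refine le_trans ?_ key
      rw [volume_eq_lintegral_toLp hK.isClosed.measurableSet,
        ← lintegral_const_mul _ (measurable_one.indicator (hm hK.isClosed.measurableSet))]
      refine lintegral_mono fun x => ?_
      by_cases hx : WithLp.toLp 2 x ∈ K
      · have : (WithLp.toLp 2 ⁻¹' K).indicator (1 : (Fin d → ℝ) → ℝ≥0∞) x = 1 :=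
          indicator_of_mem (s := WithLp.toLp 2 ⁻¹' K) hx 1
        rw [this, mul_one]
        calc ENNReal.ofReal s ^ p
            = ∏ _i : Fin d, ENNReal.ofReal s ^ ((1 : ℝ) / (d - 1)) := by
              rw [Finset.prod_const, Finset.card_fin, ← ENNReal.rpow_natCast,
                ← ENNReal.rpow_mul]
              congr 1
              rw [hp]; field_simp
          _ ≤ _ := by
              rw [Fintype.card_fin]
              refine Finset.prod_le_prod' fun i _ => ?_
              exact ENNReal.rpow_le_rpow (hline x hx i) (by positivity)
      · have : (WithLp.toLp 2 ⁻¹' K).indicator (1 : (Fin d → ℝ) → ℝ≥0∞) x = 0 :=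
          indicator_of_notMem (s := WithLp.toLp 2 ⁻¹' K) hx 1
        rw [this, mul_zero]
        exact zero_le
    have hinv : (1 - 1 / (d : ℝ)) = p⁻¹ := by rw [hp]; field_simp
    rw [hinv, ← ENNReal.rpow_le_rpow_iff hp0, ENNReal.mul_rpow_of_nonneg _ _ hp0.le,
      ENNReal.rpow_inv_rpow hp0.ne']
    exact hlow

/-- A set and its closure have the same open neighbourhood. This allows closed sets, with measurable
annuli, to replace arbitrary ones. -/
lemma annulus_closure_subset {d : ℕ} (s : ℝ) (F : Set (EuclideanSpace ℝ (Fin d))) :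
    annulus s (closure F) ⊆ annulus s F := by
  rw [annulus, annulus, thickening_closure]
  exact sdiff_subset_sdiff_right subset_closure

/-- A weak isoperimetric inequality. -/
lemma volume_annulus_ge {d : ℕ} (hd : 1 ≤ d) {F : Set (EuclideanSpace ℝ (Fin d))}
    (hF : Bornology.IsBounded F) (hne : F.Nonempty) (s : ℝ) :
    ENNReal.ofReal s * volume F ^ (1 - 1 / (d : ℝ)) ≤ volume (annulus s F) := by
  have hexp : (0 : ℝ) ≤ 1 - 1 / (d : ℝ) := by
    have : (1 : ℝ) ≤ d := by exact_mod_cast hd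
    rw [sub_nonneg, div_le_one (by linarith)]
    exact this
  calc ENNReal.ofReal s * volume F ^ (1 - 1 / (d : ℝ))
      ≤ ENNReal.ofReal s * volume (closure F) ^ (1 - 1 / (d : ℝ)) := by
        gcongr; exact subset_closure
    _ ≤ volume (annulus s (closure F)) :=
        volume_annulus_of_isCompact hd hF.isCompact_closure hne.closure s
    _ ≤ _ := measure_mono (annulus_closure_subset s F)

end Isoperimetric

/-! ### Relative perimeter -/

lemma limsup_add_le_ennreal {ι : Type*} {f : Filter ι} (u v : ι → ℝ≥0∞) :
    limsup (fun i => u i + v i) f ≤ limsup u f + limsup v f := by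
  refine ENNReal.le_of_forall_pos_le_add fun ε hε hfin => ?_
  rw [ENNReal.add_lt_top] at hfin
  have hε2 : (ε / 2 : ℝ≥0∞) ≠ 0 := by simpa using hε.ne'
  have hu := eventually_lt_of_limsup_lt (ENNReal.lt_add_right hfin.1.ne hε2)
  have hv := eventually_lt_of_limsup_lt (ENNReal.lt_add_right hfin.2.ne hε2)
  refine limsup_le_of_le (by isBoundedDefault) ?_
  filter_upwards [hu, hv] with i hi hi'
  calc u i + v i ≤ (limsup u f + ε / 2) + (limsup v f + ε / 2) := add_le_add hi.le hi'.le
    _ = _ := by rw [add_add_add_comm, ENNReal.add_halves]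

section Perimeter

variable {d : ℕ}

/-- The least volume of an annulus of width `s` around a bounded set containing `S`. -/
noncomputable def annulusVolume (s : ℝ) (S : Set (EuclideanSpace ℝ (Fin d))) : ℝ≥0∞ :=
  ⨅ (F : Set (EuclideanSpace ℝ (Fin d))) (_ : S ⊆ F ∧ Bornology.IsBounded F),
    volume (annulus s F)

lemma annulusVolume_le {s : ℝ} {S F : Set (EuclideanSpace ℝ (Fin d))} (hSF : S ⊆ F)
    (hF : Bornology.IsBounded F) : annulusVolume s S ≤ volume (annulus s F) :=
  iInf₂_le F ⟨hSF, hF⟩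

@[simp] lemma annulusVolume_empty (s : ℝ) :
    annulusVolume s (∅ : Set (EuclideanSpace ℝ (Fin d))) = 0 := by
  have := annulusVolume_le (s := s) (subset_refl (∅ : Set (EuclideanSpace ℝ (Fin d))))
    Bornology.isBounded_empty
  simpa [annulus] using this

lemma annulus_union_subset (s : ℝ) (F G : Set (EuclideanSpace ℝ (Fin d))) :
    annulus s (F ∪ G) ⊆ annulus s F ∪ annulus s G := by
  rintro x ⟨hx, hx'⟩
  rw [thickening_union] at hx
  rw [mem_union, not_or] at hx'
  exact hx.imp (fun h => ⟨h, hx'.1⟩) fun h => ⟨h, hx'.2⟩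

lemma annulusVolume_union_le (s : ℝ) (S T : Set (EuclideanSpace ℝ (Fin d))) :
    annulusVolume s (S ∪ T) ≤ annulusVolume s S + annulusVolume s T := by
  conv_rhs => rw [annulusVolume, annulusVolume]
  refine ENNReal.le_iInf₂_add_iInf₂ fun F hF G hG => ?_
  exact (annulusVolume_le (union_subset_union hF.1 hG.1) (hF.2.union hG.2)).trans
    ((measure_mono (annulus_union_subset s F G)).trans (measure_union_le _ _))

/-- Peeling an annulus of width `r` into `p` layers of width `s`. -/
lemma mul_annulusVolume_le {s r : ℝ} (hs : 0 < s) (p : ℕ) (hp : p * s ≤ r)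
    {S E Y : Set (EuclideanSpace ℝ (Fin d))} (hSE : S ⊆ E) (hE : Bornology.IsBounded E)
    (hY : MeasurableSet Y) :
    p * annulusVolume s S ≤ volume (annulus r E \ Y) + p * annulusVolume s Y := by
  -- Removing closed neighbourhoods from open ones makes the layers disjoint from each other and
  -- from `E`.
  set L : ℕ → Set (EuclideanSpace ℝ (Fin d)) := fun i =>
    thickening ((i + 1 : ℕ) * s) E \ cthickening (i * s) E with hL
  have hLm : ∀ i, MeasurableSet (L i \ Y) := fun i =>
    (isOpen_thickening.measurableSet.diff isClosed_cthickening.measurableSet).diff hY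
  have hLd : Pairwise (Function.onFun Disjoint fun i => L i \ Y) := by
    refine (pairwise_disjoint_on _).2 fun i j hij => ?_
    refine disjoint_left.2 fun x hx hx' => hx'.1.2 ?_
    refine thickening_subset_cthickening_of_le ?_ _ hx.1.1
    gcongr
    exact_mod_cast hij
  have hLsub : ⋃ i ∈ Finset.range p, L i \ Y ⊆ annulus r E \ Y := by
    refine iUnion₂_subset fun i hi x hx => ⟨⟨?_, fun h => hx.1.2 ?_⟩, hx.2⟩
    · refine thickening_mono ?_ _ hx.1.1
      refine le_trans ?_ hp
      gcongr
      exact Finset.mem_range.1 hi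
    · exact self_subset_cthickening E h
  have hsum : ∑ i ∈ Finset.range p, volume (L i \ Y) ≤ volume (annulus r E \ Y) := by
    rw [← measure_biUnion_finset (fun i _ j _ hij => hLd hij) fun i _ => hLm i]
    exact measure_mono hLsub
  -- The competitor is the closed i * s-neighbourhood of `E` together with some F ⊇ Y: its annulus
  -- lies in the i-th layer outside `Y` and in the annulus of F.
  have hstep : ∀ i, annulusVolume s S ≤ volume (L i \ Y) + annulusVolume s Y := by
    intro i
    conv_rhs => rw [annulusVolume]
    simp only [ENNReal.add_iInf]
    refine le_iInf₂ fun F hF => ?_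
    refine (annulusVolume_le (F := cthickening (i * s) E ∪ F)
      (fun x hx => Or.inl (self_subset_cthickening E (hSE hx)))
      (hE.cthickening.union hF.2)).trans ?_
    refine (measure_mono (t := L i \ Y ∪ annulus s F) ?_).trans (measure_union_le _ _)
    rintro x ⟨hx, hx'⟩
    rw [thickening_union] at hx
    rw [mem_union, not_or] at hx'
    rcases hx with hx | hx
    · refine Or.inl ⟨⟨?_, hx'.1⟩, fun h => hx'.2 (hF.1 h)⟩
      have := thickening_cthickening_subset s (by positivity : 0 ≤ i * s) E hx
      push_cast
      rwa [add_comm, ← add_one_mul] at this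
    · exact Or.inr ⟨hx, hx'.2⟩
  calc p * annulusVolume s S = ∑ i ∈ Finset.range p, annulusVolume s S := by simp
    _ ≤ ∑ i ∈ Finset.range p, (volume (L i \ Y) + annulusVolume s Y) :=
        Finset.sum_le_sum fun i _ => hstep i
    _ ≤ _ := by
        rw [Finset.sum_add_distrib]
        simp only [Finset.sum_const, Finset.card_range, nsmul_eq_mul]
        gcongr

/-- The relative perimeter of a set: the least upper Minkowski content at small scales of the
boundaries of bounded sets containing it. -/
noncomputable def perimeter (S : Set (EuclideanSpace ℝ (Fin d))) : ℝ≥0∞ :=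
  limsup (fun s : ℝ => annulusVolume s S / ENNReal.ofReal s) (𝓝[>] 0)

@[simp] lemma perimeter_empty : perimeter (∅ : Set (EuclideanSpace ℝ (Fin d))) = 0 := by
  simp [perimeter]

lemma perimeter_union_le (S T : Set (EuclideanSpace ℝ (Fin d))) :
    perimeter (S ∪ T) ≤ perimeter S + perimeter T := by
  refine le_trans (limsup_le_limsup (Eventually.of_forall fun s => ?_))
    (limsup_add_le_ennreal (u := fun s : ℝ => annulusVolume s S / ENNReal.ofReal s)
      (v := fun s : ℝ => annulusVolume s T / ENNReal.ofReal s))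
  simp only [← ENNReal.add_div]
  gcongr
  exact annulusVolume_union_le s S T

lemma perimeter_biUnion_le {ι : Type*} (t : Finset ι) (S : ι → Set (EuclideanSpace ℝ (Fin d))) :
    perimeter (⋃ i ∈ t, S i) ≤ ∑ i ∈ t, perimeter (S i) := by
  classical
  induction t using Finset.induction_on with
  | empty => simp
  | insert a t ha ih =>
    rw [Finset.set_biUnion_insert, Finset.sum_insert ha]
    exact (perimeter_union_le _ _).trans (by gcongr)

/-- The part of an annulus outside a set `Y` has large volume unless `Y` has large perimeter. -/
lemma perimeter_le_of_subset {r : ℝ} (hr : 0 < r) {S E Y : Set (EuclideanSpace ℝ (Fin d))}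
    (hSE : S ⊆ E) (hE : Bornology.IsBounded E) (hY : MeasurableSet Y) :
    perimeter S ≤ 2 * volume (annulus r E \ Y) / ENNReal.ofReal r + perimeter Y := by
  have hev : ∀ᶠ s : ℝ in 𝓝[>] 0, annulusVolume s S / ENNReal.ofReal s ≤
      2 * volume (annulus r E \ Y) / ENNReal.ofReal r +
        annulusVolume s Y / ENNReal.ofReal s := by
    filter_upwards [Ioc_mem_nhdsGT hr] with s hs
    have hs0 : 0 < s := hs.1
    -- As many layers as fit. Since p ≥ 1, they fill at least half the width, whence the factor 2.
    set p := ⌊r / s⌋₊ with hp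
    have h1 : (1 : ℝ) ≤ r / s := (one_le_div hs0).2 hs.2
    have hp1 : 1 ≤ p := Nat.one_le_floor_iff _ |>.2 h1
    have hps : p * s ≤ r := (le_div_iff₀ hs0).1 (Nat.floor_le (by positivity))
    have hpr : r ≤ 2 * (p * s) := by
      have h2 : r / s < p + 1 := Nat.lt_floor_add_one _
      rw [div_lt_iff₀ hs0] at h2
      have : (1 : ℝ) ≤ p := by exact_mod_cast hp1
      nlinarith
    have key := mul_annulusVolume_le hs0 p hps hSE hE hY
    have hp0 : (p : ℝ≥0∞) ≠ 0 := by exact_mod_cast (by omega : p ≠ 0)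
    have hpt : (p : ℝ≥0∞) ≠ ⊤ := ENNReal.natCast_ne_top p
    have key2 : annulusVolume s S ≤ volume (annulus r E \ Y) / p + annulusVolume s Y := by
      rw [← ENNReal.mul_le_mul_iff_right hp0 hpt, mul_add, ENNReal.mul_div_cancel hp0 hpt]
      exact key
    calc annulusVolume s S / ENNReal.ofReal s
        ≤ (volume (annulus r E \ Y) / p + annulusVolume s Y) / ENNReal.ofReal s := by gcongr
      _ = volume (annulus r E \ Y) / p / ENNReal.ofReal s +
          annulusVolume s Y / ENNReal.ofReal s := ENNReal.add_div
      _ ≤ _ := by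
        gcongr ?_ + _
        have hso : ENNReal.ofReal s ≠ 0 := by simpa using hs0
        have hro : ENNReal.ofReal r ≠ 0 := by simpa using hr
        rw [ENNReal.div_le_iff_le_mul (Or.inl hso) (Or.inl ENNReal.ofReal_ne_top),
          ENNReal.div_le_iff_le_mul (Or.inl hp0) (Or.inl hpt)]
        have h3 : ENNReal.ofReal r ≤ 2 * ENNReal.ofReal s * p := by
          have : (2 * ENNReal.ofReal s * p) = ENNReal.ofReal (2 * (p * s)) := by
            rw [ENNReal.ofReal_mul (by norm_num), ENNReal.ofReal_mul (by positivity),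
              ENNReal.ofReal_natCast, ENNReal.ofReal_ofNat]
            ring
          rw [this]
          exact ENNReal.ofReal_le_ofReal hpr
        calc volume (annulus r E \ Y)
            = volume (annulus r E \ Y) / ENNReal.ofReal r * ENNReal.ofReal r :=
              (ENNReal.div_mul_cancel hro ENNReal.ofReal_ne_top).symm
          _ ≤ volume (annulus r E \ Y) / ENNReal.ofReal r * (2 * ENNReal.ofReal s * p) := by
              gcongr
          _ = _ := by simp only [div_eq_mul_inv]; ring
  refine (limsup_le_limsup hev).trans ?_
  refine (limsup_add_le_ennreal (u := fun _ : ℝ => 2 * volume (annulus r E \ Y) / ENNReal.ofReal r)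
    (v := fun s : ℝ => annulusVolume s Y / ENNReal.ofReal s)).trans ?_
  rw [limsup_const]
  exact le_rfl

/-- Every competitor contains `S`, so isoperimetry bounds its annulus at every scale. Nonemptiness
matters for d = 1, where the left side is 1 even for null sets. -/
lemma perimeter_ge (hd : 1 ≤ d) {S : Set (EuclideanSpace ℝ (Fin d))} (hS : S.Nonempty) :
    volume S ^ (1 - 1 / (d : ℝ)) ≤ perimeter S := by
  have hexp : (0 : ℝ) ≤ 1 - 1 / (d : ℝ) := by
    have : (1 : ℝ) ≤ d := by exact_mod_cast hd
    rw [sub_nonneg, div_le_one (by linarith)]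
    exact this
  have hev : ∀ᶠ s : ℝ in 𝓝[>] 0, volume S ^ (1 - 1 / (d : ℝ)) ≤
      annulusVolume s S / ENNReal.ofReal s := by
    filter_upwards [self_mem_nhdsWithin] with s hs
    have hso : ENNReal.ofReal s ≠ 0 := by simpa using hs
    rw [ENNReal.le_div_iff_mul_le (Or.inl hso) (Or.inl ENNReal.ofReal_ne_top), mul_comm]
    refine le_iInf₂ fun F hF => ?_
    refine le_trans ?_ (volume_annulus_ge hd hF.2 (hS.mono hF.1) s)
    gcongr
    exact hF.1
  exact le_trans (le_of_eq (limsup_const _).symm) (limsup_le_limsup hev)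

end Perimeter

/-! ### Recursive inequalities along a divergent series -/

section Sequences

lemma le_two_pow_mul {t : ℕ → ℝ} (ht : ∀ i, t (i + 1) ≤ 2 * t i) (n i : ℕ) :
    t (n + i) ≤ 2 ^ i * t n := by
  induction i with
  | zero => simp
  | succ i ih =>
    calc t (n + (i + 1)) ≤ 2 * t (n + i) := ht (n + i)
      _ ≤ 2 * (2 ^ i * t n) := by gcongr
      _ = _ := by ring

/-- Each extra term t (j + q) ≤ 2 ^ q * t j at most doubles the bound. This absorbs the q levels
lost before the families of sets start. -/
lemma sum_range_add_le {t : ℕ → ℝ} (ht0 : ∀ i, 0 < t i) (ht : ∀ i, t (i + 1) ≤ 2 * t i)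
    (q j : ℕ) :
    ∑ i ∈ Finset.range (q + j), t i ≤ 2 ^ q * ∑ i ∈ Finset.range (j + 1), t i := by
  induction q with
  | zero => simpa [Finset.sum_range_succ] using (ht0 j).le
  | succ q ih =>
    have h1 := le_two_pow_mul ht j q
    have h2 : t j ≤ ∑ i ∈ Finset.range (j + 1), t i :=
      Finset.single_le_sum (fun i _ => (ht0 i).le) (Finset.self_mem_range_succ j)
    have h3 : (2 : ℝ) ^ q * t j ≤ 2 ^ q * ∑ i ∈ Finset.range (j + 1), t i := by gcongr
    set T := ∑ i ∈ Finset.range (j + 1), t i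
    rw [show q + 1 + j = q + j + 1 by ring, Finset.sum_range_succ, pow_succ, add_comm q j]
    rw [add_comm q j] at ih
    linarith

/-- `M` is the first index where the sum beyond n + l reaches Λ * t n. The overshoot is at most t M
≤ 2 * t (M - 1), and t (M - 1) is controlled because the threshold was not yet reached; hence the
factor 3. -/
lemma exists_sum_comparable {t : ℕ → ℝ} (ht0 : ∀ i, 0 < t i) (ht : ∀ i, t (i + 1) ≤ 2 * t i)
    (hns : ¬ Summable t) (l : ℕ) {Λ : ℝ} (hΛ : 0 < Λ) (n : ℕ) :
    ∃ M, Λ * t n ≤ ∑ i ∈ Finset.Ioc (n + l) M, t i ∧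
      ∑ i ∈ Finset.range (M + 1), t i ≤
        ∑ i ∈ Finset.range (n + 1), t i + 3 * (l * 2 ^ l + Λ + 1) * t n := by
  set σ : ℕ → ℝ := fun m => ∑ i ∈ Finset.range (m + 1), t i with hσ
  have hmono : Monotone σ := fun a b hab =>
    Finset.sum_le_sum_of_subset_of_nonneg (Finset.range_mono (by omega)) fun i _ _ => (ht0 i).le
  have htend : Tendsto σ atTop atTop :=
    ((not_summable_iff_tendsto_nat_atTop_of_nonneg fun i => (ht0 i).le).1 hns).comp
      (tendsto_add_atTop_nat 1)
  have hex : ∃ M, σ (n + l) + Λ * t n ≤ σ M := (htend.eventually_ge_atTop _).exists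
  classical
  set M := Nat.find hex with hM
  have hMs : σ (n + l) + Λ * t n ≤ σ M := Nat.find_spec hex
  have hpos : 0 < Λ * t n := mul_pos hΛ (ht0 n)
  have hlt : n + l < M := by
    by_contra h
    have := hmono (not_lt.1 h)
    linarith
  obtain ⟨M', hM'⟩ : ∃ M', M = M' + 1 := ⟨M - 1, by omega⟩
  have hM'lt : σ M' < σ (n + l) + Λ * t n := not_le.1 (Nat.find_min hex (by omega))
  have hsplit : ∀ j, σ (n + j) ≤ σ n + j * 2 ^ j * t n := by
    intro j
    induction j with
    | zero => simp
    | succ j ih =>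
      have h1 := le_two_pow_mul ht n (j + 1)
      have h2 : σ (n + (j + 1)) = σ (n + j) + t (n + (j + 1)) := Finset.sum_range_succ _ _
      rw [h2]
      have h3 : (j : ℝ) * 2 ^ j * t n ≤ j * 2 ^ (j + 1) * t n := by
        have := (ht0 n).le
        gcongr
        · norm_num
        · omega
      push_cast
      linarith
  have hl := hsplit l
  have ht' : t M' ≤ (l * 2 ^ l + Λ + 1) * t n := by
    rcases (show n ≤ M' by omega).eq_or_lt with h | h
    · rw [← h]
      have : 0 ≤ (l * 2 ^ l + Λ : ℝ) * t n := by have := ht0 n; positivity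
      linarith
    · obtain ⟨b, hb⟩ : ∃ b, M' = b + 1 := ⟨M' - 1, by omega⟩
      have h1 : σ M' = σ b + t M' := by rw [hb]; exact Finset.sum_range_succ _ _
      have h2 : σ n ≤ σ b := hmono (by omega)
      have := ht0 n
      linarith
  have hMstep : σ M = σ M' + t M := by rw [hM']; exact Finset.sum_range_succ _ _
  have htM : t M ≤ 2 * t M' := by rw [hM']; exact ht M'
  refine ⟨M, ?_, ?_⟩
  · have : σ (n + l) + ∑ i ∈ Finset.Ioc (n + l) M, t i = σ M := by
      rw [hσ]
      simp only
      rw [← Finset.sum_range_add_sum_Ico t (show n + l + 1 ≤ M + 1 by omega)]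
      congr 1
      exact Finset.sum_congr (by ext; simp) fun _ _ => rfl
    linarith
  · change σ M ≤ σ n + _
    have := ht0 n
    linarith

/-- A sequence that is forced to grow along a divergent series cannot be bounded. -/
lemma exists_forall_lt_of_recursion (l : ℕ) {B : ℝ} (hB : 0 ≤ B) :
    ∃ δ : ℝ, 0 < δ ∧ ∀ (t : ℕ → ℝ) (e : ℕ → ℕ → ℝ) (H : ℕ → ℝ) (K : ℝ),
      (∀ i, 0 < t i) → (∀ i, t (i + 1) ≤ 2 * t i) → ¬ Summable t →
      (∀ n m, n ≤ m → 0 ≤ e n m) → (∀ n M, ∑ m ∈ Finset.Icc n M, e n m ≤ B) →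
      (∀ n m, n + l ≤ m → e n m ≤ 1 / 4) →
      (∀ n, 0 ≤ H n) → (∀ n, H n ≤ K) →
      (∀ n m, n + l ≤ m →
        H n ≤ δ * ∑ i ∈ Finset.range (m + 1), t i + e n m * (t n / t m) * H m) →
      H 0 < t 0 := by
  -- Λ makes the window sum exceed 8 * B * t n, so the averaged error is at most half of H n. With κ
  -- = 1 / K₂, the partial sums times κ grow by at most t n up to the end of the window.
  set Λ : ℝ := 8 * B + 1 with hΛ
  have hΛ0 : 0 < Λ := by positivity
  set K₂ : ℝ := 3 * (l * 2 ^ l + Λ + 1) with hK₂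
  have hK₂1 : 1 ≤ K₂ := by
    have : (0 : ℝ) ≤ l * 2 ^ l := by positivity
    linarith
  have hK₂0 : 0 < K₂ := by linarith
  set κ : ℝ := K₂⁻¹ with hκ
  have hκ0 : 0 < κ := by positivity
  refine ⟨κ / 16, by positivity, fun t e H K ht0 ht hns he0 heB he4 hH0 hHK hrec => ?_⟩
  by_contra hcon
  rw [not_lt] at hcon
  set σ : ℕ → ℝ := fun m => ∑ i ∈ Finset.range (m + 1), t i with hσ
  have hmono : Monotone σ := fun a b hab =>
    Finset.sum_le_sum_of_subset_of_nonneg (Finset.range_mono (by omega)) fun i _ _ => (ht0 i).le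
  have hσ0 : σ 0 = t 0 := by simp [hσ]
  -- The weight is bounded away from 0, so H / w is bounded, and w 0 = t 0 makes its supremum at
  -- least 1. The index n below attains the supremum up to a factor 2.
  set w : ℕ → ℝ := fun m => max (t m) (κ * σ m) with hw
  have hw0 : ∀ m, 0 < w m := fun m => lt_max_of_lt_left (ht0 m)
  have hwκ : ∀ m, κ * t 0 ≤ w m := fun m => by
    refine le_trans ?_ (le_max_right _ _)
    rw [← hσ0]
    exact mul_le_mul_of_nonneg_left (hmono (Nat.zero_le m)) hκ0.le
  have hκt : 0 < κ * t 0 := mul_pos hκ0 (ht0 0)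
  have hbdd : BddAbove (range fun m => H m / w m) := by
    refine ⟨K / (κ * t 0), ?_⟩
    rintro _ ⟨m, rfl⟩
    exact div_le_div₀ ((hH0 m).trans (hHK m)) (hHK m) hκt (hwκ m)
  have hκ1 : κ ≤ 1 := inv_le_one_of_one_le₀ hK₂1
  have hw00 : w 0 = t 0 := by
    simp only [hw, hσ0]
    refine max_eq_left ?_
    have := ht0 0
    nlinarith
  have hQ : 1 ≤ sSup (range fun m => H m / w m) := by
    refine le_trans ?_ (le_csSup hbdd ⟨0, rfl⟩)
    simp only
    rw [hw00, one_le_div (ht0 0)]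
    exact hcon
  obtain ⟨_, ⟨n, rfl⟩, hn⟩ := exists_lt_of_lt_csSup (range_nonempty _)
    (show sSup (range fun m => H m / w m) / 2 < sSup (range fun m => H m / w m) by linarith)
  have hmax : ∀ m, H m ≤ 2 * w m * (H n / w n) := by
    intro m
    have h1 := le_csSup hbdd ⟨m, rfl⟩
    simp only at h1 hn
    rw [div_le_iff₀ (hw0 m)] at h1
    refine h1.trans ?_
    have := hw0 m
    nlinarith
  have hHn : w n / 2 ≤ H n := by
    have h1 : (1 : ℝ) / 2 ≤ H n / w n := by
      simp only at hn
      linarith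
    rw [le_div_iff₀ (hw0 n)] at h1
    linarith
  obtain ⟨M, hM1, hM2⟩ := exists_sum_comparable ht0 ht hns l hΛ0 n
  have hσM : κ * σ M ≤ 2 * w n := by
    have h1 : κ * (K₂ * t n) = t n := by rw [hκ]; field_simp
    have h2 : κ * σ n ≤ w n := le_max_right _ _
    have h3 : t n ≤ w n := le_max_left _ _
    have h4 : κ * σ M ≤ κ * (σ n + K₂ * t n) := mul_le_mul_of_nonneg_left hM2 hκ0.le
    linarith
  -- Such a bound gives H n ≤ w n / 4, against H n ≥ w n / 2.
  have hfin : H n ≤ 2 * (κ / 16 * σ M) → False := by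
    intro h
    have := hw0 n
    linarith
  have hHn0 : 0 < H n := by have := hw0 n; linarith
  -- If t m is this large, then w m = t m, and e n m ≤ 1/4 makes the last term at most H n / 2 at
  -- this single m. Otherwise H m ≤ 4 * H n on the whole window; averaging with weights t m cancels
  -- the 1 / t m, and only the bound on the sum of e counts.
  by_cases hcase : ∃ m ∈ Finset.Ioc (n + l) M, 2 * w n ≤ t m
  · obtain ⟨m, hm, hmt⟩ := hcase
    rw [Finset.mem_Ioc] at hm
    have hσm : κ * σ m ≤ κ * σ M := mul_le_mul_of_nonneg_left (hmono hm.2) hκ0.le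
    have hwm : w m = t m := max_eq_left (by linarith)
    have h1 := hrec n m hm.1.le
    have h2 := hmax m
    rw [hwm] at h2
    have h3 : e n m * (t n / t m) * H m ≤ 1 / 4 * (t n / t m) * (2 * t m * (H n / w n)) := by
      have := ht0 n
      have := ht0 m
      have := hH0 m
      have := he4 n m hm.1.le
      gcongr
    have h4 : 1 / 4 * (t n / t m) * (2 * t m * (H n / w n)) = 1 / 2 * (t n / w n) * H n := by
      have := (ht0 m).ne'
      field_simp
      ring
    have h5 : t n / w n ≤ 1 := (div_le_one (hw0 n)).2 (le_max_left _ _)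
    have h6 : 1 / 2 * (t n / w n) * H n ≤ 1 / 2 * 1 * H n := by gcongr
    refine hfin ?_
    change H n ≤ κ / 16 * σ m + _ at h1
    linarith
  · push Not at hcase
    have hHm : ∀ m ∈ Finset.Ioc (n + l) M, H m ≤ 4 * H n := by
      intro m hm
      have h1 := hcase m hm
      rw [Finset.mem_Ioc] at hm
      have hσm : κ * σ m ≤ κ * σ M := mul_le_mul_of_nonneg_left (hmono hm.2) hκ0.le
      have hwm : w m ≤ 2 * w n := max_le h1.le (by linarith)
      calc H m ≤ 2 * w m * (H n / w n) := hmax m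
        _ ≤ 2 * (2 * w n) * (H n / w n) := by
          have := hw0 n
          gcongr
        _ = 4 * H n := by
          have := (hw0 n).ne'
          field_simp
          ring
    set S := ∑ i ∈ Finset.Ioc (n + l) M, t i with hS
    have hS0 : 0 < S := lt_of_lt_of_le (mul_pos hΛ0 (ht0 n)) hM1
    have hsum : S * H n ≤ S * (κ / 16 * σ M) + B * (4 * t n * H n) := by
      calc S * H n = ∑ m ∈ Finset.Ioc (n + l) M, t m * H n := by rw [hS, Finset.sum_mul]
        _ ≤ ∑ m ∈ Finset.Ioc (n + l) M,
            (t m * (κ / 16 * σ M) + e n m * (4 * t n * H n)) := by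
          refine Finset.sum_le_sum fun m hm => ?_
          have h4 := hHm m hm
          rw [Finset.mem_Ioc] at hm
          have h1 := hrec n m hm.1.le
          have h2 : σ m ≤ σ M := hmono hm.2
          have h3 := he0 n m (by omega)
          have htm := ht0 m
          have htn := ht0 n
          calc t m * H n ≤ t m * (κ / 16 * σ m + e n m * (t n / t m) * H m) := by gcongr
            _ = t m * (κ / 16 * σ m) + e n m * (t n * H m) := by field_simp
            _ ≤ t m * (κ / 16 * σ M) + e n m * (t n * (4 * H n)) := by gcongr
            _ = _ := by ring
        _ = S * (κ / 16 * σ M) + (∑ m ∈ Finset.Ioc (n + l) M, e n m) * (4 * t n * H n) := by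
          rw [Finset.sum_add_distrib, ← Finset.sum_mul, ← Finset.sum_mul]
        _ ≤ _ := by
          have htn := ht0 n
          gcongr
          refine le_trans (Finset.sum_le_sum_of_subset_of_nonneg (t := Finset.Icc n M) ?_ ?_)
            (heB n M)
          · intro i hi
            rw [Finset.mem_Ioc] at hi
            exact Finset.mem_Icc.2 ⟨by omega, hi.2⟩
          · intro i hi _
            exact he0 n i (Finset.mem_Icc.1 hi).1
    have h1 : B * (4 * t n * H n) ≤ S / 2 * H n := by
      have : 8 * B * t n ≤ S := by
        have := ht0 n
        linarith
      nlinarith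
    refine hfin ?_
    have h2 : S * (H n / 2) ≤ S * (κ / 16 * σ M) := by linarith
    have := le_of_mul_le_mul_left h2 hS0
    linarith

/-- `k` minimises y m plus η times the m-th partial sum, a quantity that tends to infinity. -/
lemma exists_forall_sub_le_sum {y t : ℕ → ℝ} (hy : ∀ n, 0 ≤ y n) (ht0 : ∀ i, 0 ≤ t i)
    (hns : ¬ Summable t) {η : ℝ} (hη : 0 < η) :
    ∃ k, ∀ j, y k - y (k + j) ≤ η * ∑ i ∈ Finset.range j, t (k + i) := by
  have htend : Tendsto (fun m => y m + η * ∑ i ∈ Finset.range m, t i) cofinite atTop := by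
    rw [Nat.cofinite_eq_atTop]
    exact tendsto_atTop_mono (fun m => le_add_of_nonneg_left (hy m))
      (((not_summable_iff_tendsto_nat_atTop_of_nonneg ht0).1 hns).const_mul_atTop hη)
  obtain ⟨k, hk⟩ := htend.exists_forall_le
  refine ⟨k, fun j => ?_⟩
  have := hk (k + j)
  rw [Finset.sum_range_add, mul_add] at this
  linarith

lemma pow_sub_pow_le_mul {a b : ℝ} (hb : 0 ≤ b) (hab : b ≤ a) (d : ℕ) :
    a ^ d - b ^ d ≤ d * a ^ (d - 1) * (a - b) := by
  have ha := hb.trans hab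
  have h : ∀ d : ℕ, a ^ (d + 1) - b ^ (d + 1) ≤ (d + 1) * a ^ d * (a - b) := by
    intro d
    induction d with
    | zero => simp
    | succ d ih =>
      have h1 : b ^ (d + 1) ≤ a ^ (d + 1) := pow_le_pow_left₀ hb hab _
      have h2 : (a - b) * b ^ (d + 1) ≤ (a - b) * a ^ (d + 1) :=
        mul_le_mul_of_nonneg_left h1 (by linarith)
      have h3 := mul_le_mul_of_nonneg_left ih ha
      calc a ^ (d + 1 + 1) - b ^ (d + 1 + 1)
          = a * (a ^ (d + 1) - b ^ (d + 1)) + (a - b) * b ^ (d + 1) := by ring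
        _ ≤ a * ((d + 1) * a ^ d * (a - b)) + (a - b) * a ^ (d + 1) := by linarith
        _ = _ := by push_cast; ring
  cases d with
  | zero => simp
  | succ d => simpa using h d

lemma summable_of_recursion {d : ℕ} (hd : 1 ≤ d) (q l : ℕ) {B γ c K₁ : ℝ} (hB : 0 ≤ B)
    (hγ : 0 < γ) (hc : 0 < c) (hK₁ : 0 ≤ K₁) {s y : ℕ → ℝ} {e : ℕ → ℕ → ℝ}
    (hs0 : ∀ n, 1 ≤ n → 0 < s n) (hs : ∀ n, 1 ≤ n → s (n + 1) ≤ 2 * s n)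
    (hy : ∀ n, 1 ≤ n → c * s n ≤ y n)
    (hanti : ∀ n m, 1 ≤ n → n ≤ m → y m ≤ y n)
    (he0 : ∀ n m, 1 ≤ n → n ≤ m → 0 ≤ e n m)
    (heB : ∀ n M, 1 ≤ n → ∑ m ∈ Finset.Icc n M, e n m ≤ B)
    (he4 : ∀ n m, 1 ≤ n → n + l ≤ m → e n m ≤ 1 / 4)
    (hH : ∀ k, 1 ≤ k → ∃ (H : ℕ → ℝ) (K : ℝ), (∀ n, 0 ≤ H n) ∧ (∀ n, k + q ≤ n → H n ≤ K) ∧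
      γ * s (k + q) * y (k + q) ^ (d - 1) ≤ H (k + q) ∧
      ∀ n m, k + q ≤ n → n + l ≤ m →
        H n ≤ K₁ * (y k ^ d - y m ^ d) + e n m * (s n / s m) * H m) :
    Summable fun n => s (n + 1) := by
  by_contra hns
  obtain ⟨δ, hδ, hrec⟩ := exists_forall_lt_of_recursion l hB
  have hdR : (0 : ℝ) < d := by exact_mod_cast hd
  -- The first entry ensures y k ≤ 2 * y (k + q), the second that the volume term is at most δ * σ *
  -- D; K₁ + 1 avoids a zero denominator.
  set η : ℝ := min (c / 2 ^ q) (δ * γ / ((K₁ + 1) * d * 2 ^ q * 2 ^ (d - 1))) with hη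
  have hη0 : 0 < η := by
    refine lt_min (by positivity) ?_
    have : 0 < K₁ + 1 := by linarith
    positivity
  have hη1 : η * 2 ^ q ≤ c := by
    have := min_le_left (c / 2 ^ q) (δ * γ / ((K₁ + 1) * d * 2 ^ q * 2 ^ (d - 1)))
    rwa [← hη, le_div_iff₀ (by positivity)] at this
  have hη2 : K₁ * d * η * 2 ^ q * 2 ^ (d - 1) ≤ δ * γ := by
    have h1 := min_le_right (c / 2 ^ q) (δ * γ / ((K₁ + 1) * d * 2 ^ q * 2 ^ (d - 1)))
    have h0 : 0 < K₁ + 1 := by linarith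
    rw [← hη, le_div_iff₀ (by positivity)] at h1
    have h2 : 0 ≤ η * (d * 2 ^ q * 2 ^ (d - 1)) := by positivity
    nlinarith
  have hy0 : ∀ n, 1 ≤ n → 0 < y n := fun n hn =>
    lt_of_lt_of_le (mul_pos hc (hs0 n hn)) (hy n hn)
  have hns' : ¬ Summable fun j => s (j + 1 + q) := by
    intro h
    refine hns ((summable_nat_add_iff q).1 ?_)
    simpa [add_right_comm] using h
  -- y at a level is paired with s taken q levels later, since H is controlled only from level k + q
  -- on.
  obtain ⟨k', hk'⟩ := exists_forall_sub_le_sum (y := fun j => y (j + 1))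
    (fun j => (hy0 _ (by omega)).le) (fun j => (hs0 (j + 1 + q) (by omega)).le) hns' hη0
  set k := k' + 1 with hk
  set t : ℕ → ℝ := fun i => s (k + q + i) with ht_def
  have hk1 : 1 ≤ k := by omega
  have ht0 : ∀ i, 0 < t i := fun i => hs0 _ (by omega)
  have ht : ∀ i, t (i + 1) ≤ 2 * t i := fun i => hs (k + q + i) (by omega)
  have hnst : ¬ Summable t := by
    intro h
    refine hns ((summable_nat_add_iff (k' + q)).1 ?_)
    have heq : (fun i => s (i + (k' + q) + 1)) = t := by
      funext i
      simp only [ht_def, hk]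
      congr 1
      omega
    exact heq ▸ h
  have hrise : ∀ j, y k - y (k + q + j) ≤
      η * (2 ^ q * ∑ i ∈ Finset.range (j + 1), t i) := by
    intro j
    have h1 := hk' (q + j)
    have h2 := sum_range_add_le ht0 ht q j
    calc y k - y (k + q + j) = y (k' + 1) - y (k' + (q + j) + 1) := by
          congr 2; omega
      _ ≤ η * ∑ i ∈ Finset.range (q + j), s (k' + i + 1 + q) := h1
      _ = η * ∑ i ∈ Finset.range (q + j), t i := by
          congr 1
          refine Finset.sum_congr rfl fun i _ => ?_
          simp only [ht_def, hk]
          congr 1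
          omega
      _ ≤ _ := by gcongr
  have hyk : y k ≤ 2 * y (k + q) := by
    have h1 := hrise 0
    simp only [zero_add, Finset.sum_range_one, add_zero] at h1
    have h2 : t 0 = s (k + q) := rfl
    rw [h2] at h1
    have h3 := hy (k + q) (by omega)
    have h4 : η * 2 ^ q * s (k + q) ≤ c * s (k + q) :=
      mul_le_mul_of_nonneg_right hη1 (hs0 _ (by omega)).le
    linarith
  obtain ⟨H, K, hH0, hHK, hHs, hHrec⟩ := hH k hk1
  set Y := y k ^ (d - 1) with hY
  have hY0 : 0 < Y := pow_pos (hy0 k hk1) _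
  -- As y k ≤ 2 * y (k + q), this D is at most γ * y (k + q) ^ (d - 1), so the normalised H starts
  -- at or above t 0.
  set D : ℝ := γ * Y / 2 ^ (d - 1) with hD
  have hD0 : 0 < D := by positivity
  have hlt := hrec t (fun n m => e (k + q + n) (k + q + m)) (fun n => H (k + q + n) / D) (K / D)
    ht0 ht hnst (fun n m h => he0 _ _ (by omega) (by omega))
    (fun n M => by
      refine le_trans (le_of_eq ?_) (heB (k + q + n) (k + q + M) (by omega))
      rw [← Finset.map_add_left_Icc, Finset.sum_map]
      simp)
    (fun n m h => he4 _ _ (by omega) (by omega))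
    (fun n => div_nonneg (hH0 _) hD0.le)
    (fun n => div_le_div_of_nonneg_right (hHK _ (by omega)) hD0.le)
    (fun n m h => by
      rw [div_le_iff₀ hD0]
      have h1 := hHrec (k + q + n) (k + q + m) (by omega) (by omega)
      refine h1.trans ?_
      have h2 := pow_sub_pow_le_mul (hy0 (k + q + m) (by omega)).le
        (hanti k (k + q + m) hk1 (by omega)) d
      have h3 := hrise m
      set σ := ∑ i ∈ Finset.range (m + 1), t i
      have hσ0 : 0 ≤ σ := Finset.sum_nonneg fun i _ => (ht0 i).le
      have h4 : K₁ * (y k ^ d - y (k + q + m) ^ d) ≤ K₁ * (d * Y * (η * (2 ^ q * σ))) := by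
        refine mul_le_mul_of_nonneg_left (h2.trans ?_) hK₁
        gcongr
      have h5 : K₁ * (d * Y * (η * (2 ^ q * σ))) ≤ δ * σ * D := by
        rw [hD]
        have h6 : (K₁ * d * η * 2 ^ q * 2 ^ (d - 1)) * (Y * σ / 2 ^ (d - 1)) ≤
            δ * γ * (Y * σ / 2 ^ (d - 1)) := by gcongr
        have h7 : (K₁ * d * η * 2 ^ q * 2 ^ (d - 1)) * (Y * σ / 2 ^ (d - 1)) =
            K₁ * (d * Y * (η * (2 ^ q * σ))) := by field_simp
        have h8 : δ * γ * (Y * σ / 2 ^ (d - 1)) = δ * σ * (γ * Y / 2 ^ (d - 1)) := by ring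
        linarith
      have h9 : (δ * σ + e (k + q + n) (k + q + m) * (t n / t m) * (H (k + q + m) / D)) * D =
          δ * σ * D + e (k + q + n) (k + q + m) * (t n / t m) * H (k + q + m) := by
        field_simp
      rw [h9]
      change _ + e (k + q + n) (k + q + m) * (t n / t m) * H (k + q + m) ≤ _
      linarith)
  simp only [add_zero] at hlt
  rw [div_lt_iff₀ hD0] at hlt
  have h1 : Y ≤ 2 ^ (d - 1) * y (k + q) ^ (d - 1) := by
    rw [← mul_pow]
    exact pow_le_pow_left₀ (hy0 k hk1).le hyk _
  have h2 : D ≤ γ * y (k + q) ^ (d - 1) := by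
    rw [hD, div_le_iff₀ (by positivity)]
    nlinarith
  have h3 : t 0 * D ≤ t 0 * (γ * y (k + q) ^ (d - 1)) :=
    mul_le_mul_of_nonneg_left h2 (ht0 0).le
  have h4 : t 0 = s (k + q) := rfl
  rw [h4] at h3 hlt
  linarith

end Sequences

/-! ### Regularised systems and the perimeter inequality between levels -/

section Systems

/-- The finite set of 0-1 sequences of length `n`. -/
noncomputable def words (n : ℕ) : Finset Word := (List.finite_length_eq Bool n).toFinset

@[simp] lemma mem_words {n : ℕ} {I : Word} : I ∈ words n ↔ I.length = n := by
  simp [words]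

/-- A system of open sets `S I` and closed sets `E I m j` whose annuli have the properties used in
the volume estimates. -/
structure RegularSystem (d : ℕ) (r : ℕ → ℝ) (C q : ℕ) (k : ℕ → ℕ → ℕ)
    (S : Word → Set (EuclideanSpace ℝ (Fin d)))
    (E : Word → ℕ → ℕ → Set (EuclideanSpace ℝ (Fin d))) (c B : ℝ) : Prop where
  c_pos : 0 < c
  B_nonneg : 0 ≤ B
  isOpen : ∀ I, IsOpen (S I)
  isClosed : ∀ I m j, IsClosed (E I m j)
  isBounded : ∀ I : Word, 1 ≤ I.length → Bornology.IsBounded (S I)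
  isBounded' : ∀ I : Word, 1 ≤ I.length → ∀ m, I.length ≤ m → ∀ j, Bornology.IsBounded (E I m j)
  subset : ∀ I J : Word, 1 ≤ I.length → Inside J I → S J ⊆ S I
  disjoint : ∀ I J : Word, 1 ≤ I.length → 1 ≤ J.length → Disj I J → Disjoint (S I) (S J)
  ball_subset : ∀ I : Word, 1 ≤ I.length → ∃ x, ball x (c * r I.length) ⊆ S I
  subset_E : ∀ I : Word, 1 ≤ I.length → ∀ m, I.length ≤ m → ∀ j, S I ⊆ E I m j
  meets : ∀ n m : ℕ, 1 ≤ n → n ≤ m → ∀ J : Word, J.length = m →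
    {p : Word × ℕ | p.1.length = n ∧ p.2 < k n m ∧
      (annulus (r m) (E p.1 m p.2) ∩ S J).Nonempty}.encard ≤ C
  cover : ∀ n m : ℕ, 1 ≤ n → n < m → ∀ x : EuclideanSpace ℝ (Fin d),
    ({p : Word × ℕ | p.1.length = n ∧ p.2 < k n m ∧
      x ∈ annulus (r m) (E p.1 m p.2)}.ncard : ℝ) * r n ≤ B * (k n m * r m)
  family : ∀ I : Word, 1 ≤ I.length → ∃ F : ℕ → Set Word,
    (∀ n, I.length + q ≤ n → (F n).Nonempty ∧ ∀ I' ∈ F n, I'.length = n ∧ Inside I' I) ∧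
    (∀ n m, I.length + q ≤ n → n + q ≤ m → ∀ I' ∈ F n, ∀ j < k n m,
      annulus (r m) (E I' m j) ⊆ S I ∧
      ∀ I'' : Word, I''.length = m →
        (annulus (r m) (E I' m j) ∩ S I'').Nonempty → I'' ∈ F m)

lemma finite_pairs (n K : ℕ) (P : Word × ℕ → Prop) :
    {p : Word × ℕ | p.1.length = n ∧ p.2 < K ∧ P p}.Finite :=
  (((List.finite_length_eq Bool n).prod (finite_Iio K))).subset fun _ hp => ⟨hp.1, hp.2.1⟩

/-- Interiors of the S I and closures of the E I m j serve. The annuli only shrink; being annuli of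
closed sets they are open, so those inside S I lie in its interior. -/
lemma HasAnnuliSystem.exists_regularSystem {d : ℕ} {r : ℕ → ℝ} {C q : ℕ} {k : ℕ → ℕ → ℕ}
    (hr : ∀ n, 1 ≤ n → 0 < r n) (h : HasAnnuliSystem d r C q k) :
    ∃ S E c B, RegularSystem d r C q k S E c B := by
  obtain ⟨S, E, hS, hE, hsub, hdisj, -, ⟨c, hc, hball⟩, hSE, hmeets, ⟨B, hcover⟩, hfam⟩ := h
  have hann : ∀ (s : ℝ) (I : Word) (m j : ℕ),
      annulus s (closure (E I m j)) ⊆ annulus s (E I m j) := fun s I m j =>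
    annulus_closure_subset s _
  refine ⟨fun I => interior (S I), fun I m j => closure (E I m j), c, max B 0, ?_⟩
  refine ⟨hc, le_max_right _ _, fun I => isOpen_interior, fun I m j => isClosed_closure,
    fun I hI => (hS I hI).subset interior_subset, fun I hI m hm j => (hE I hI m hm j).closure,
    fun I J hI hJ => interior_mono (hsub I J hI hJ),
    fun I J hI hJ hIJ => (hdisj I J hI hJ hIJ).mono interior_subset interior_subset, ?_,
    fun I hI m hm j => (interior_subset.trans (hSE I hI m hm j)).trans subset_closure, ?_, ?_, ?_⟩
  · intro I hI
    obtain ⟨x, hx⟩ := hball I hI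
    exact ⟨x, interior_maximal hx isOpen_ball⟩
  · intro n m hn hm J hJ
    refine le_trans (encard_le_encard ?_) (hmeets n m hn hm J hJ)
    rintro p ⟨h1, h2, x, hx, hx'⟩
    exact ⟨h1, h2, x, hann _ _ _ _ hx, interior_subset hx'⟩
  · intro n m hn hm x
    have hrn := (hr n hn).le
    have hrm := (hr m (by omega)).le
    calc _ ≤ ({p : Word × ℕ | p.1.length = n ∧ p.2 < k n m ∧
        x ∈ annulus (r m) (E p.1 m p.2)}.ncard : ℝ) * r n :=
          mul_le_mul_of_nonneg_right (Nat.cast_le.2 (ncard_le_ncard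
            (fun p hp => ⟨hp.1, hp.2.1, hann _ _ _ _ hp.2.2⟩) (finite_pairs n (k n m) _))) hrn
      _ ≤ B * (k n m * r m) := hcover n m hn hm x
      _ ≤ _ := by
          gcongr
          exact le_max_left _ _
  · intro I hI
    obtain ⟨F, hF1, hF2⟩ := hfam I hI
    refine ⟨F, hF1, fun n m hn hm I' hI' j hj => ?_⟩
    obtain ⟨h1, h2⟩ := hF2 n m hn hm I' hI' j hj
    have hlen : I'.length = n := ((hF1 n hn).2 I' hI').1
    refine ⟨?_, fun I'' hI'' hne => h2 I'' hI'' ?_⟩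
    · refine interior_maximal ((hann _ _ _ _).trans h1) ?_
      exact isOpen_thickening.sdiff isClosed_closure
    · obtain ⟨x, hx, hx'⟩ := hne
      exact ⟨x, hann _ _ _ _ hx, interior_subset hx'⟩

/-- If each point lies in at most `N` of the sets `D p`, then the volumes of their traces on `Z` add
up to at most `N` times the volume of `Z`. -/
lemma sum_measure_inter_le {α ι : Type*} [MeasurableSpace α] (μ : Measure α) (P : Finset ι)
    {D : ι → Set α} (hD : ∀ p ∈ P, MeasurableSet (D p)) (Z : Set α) {N : ℝ≥0∞}
    (hN : ∀ x, ({p ∈ (P : Set ι) | x ∈ D p}.ncard : ℝ≥0∞) ≤ N) :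
    ∑ p ∈ P, μ (D p ∩ Z) ≤ N * μ Z := by
  classical
  calc ∑ p ∈ P, μ (D p ∩ Z) = ∑ p ∈ P, ∫⁻ x in Z, (D p).indicator 1 x ∂μ := by
        refine Finset.sum_congr rfl fun p hp => ?_
        rw [lintegral_indicator_one (hD p hp), Measure.restrict_apply (hD p hp)]
    _ = ∫⁻ x in Z, ∑ p ∈ P, (D p).indicator 1 x ∂μ :=
        (lintegral_finsetSum' P fun p hp => (measurable_one.indicator (hD p hp)).aemeasurable).symm
    _ ≤ ∫⁻ _ in Z, N ∂μ := by
        refine lintegral_mono fun x => ?_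
        refine le_trans (le_of_eq ?_) (hN x)
        have : {p ∈ (P : Set ι) | x ∈ D p} = ↑(P.filter fun p => x ∈ D p) := by
          ext p; simp
        rw [this, ncard_coe_finset, Finset.card_filter]
        push_cast
        refine Finset.sum_congr rfl fun p _ => ?_
        simp [indicator_apply]
    _ = N * μ Z := by simp

namespace RegularSystem

variable {d : ℕ} {r : ℕ → ℝ} {C q : ℕ} {k : ℕ → ℕ → ℕ}
  {S : Word → Set (EuclideanSpace ℝ (Fin d))}
  {E : Word → ℕ → ℕ → Set (EuclideanSpace ℝ (Fin d))} {c B : ℝ}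

lemma perimeter_lt_top (h : RegularSystem d r C q k S E c B) {I : Word} (hI : 1 ≤ I.length) :
    perimeter (S I) < ⊤ := by
  refine (perimeter_le_of_subset one_pos (subset_refl (S I)) (h.isBounded I hI)
    MeasurableSet.empty).trans_lt ?_
  have h1 : volume (annulus 1 (S I) \ ∅) < ⊤ :=
    (((h.isBounded I hI).thickening).subset
      (sdiff_subset.trans sdiff_subset)).measure_lt_top
  rw [perimeter_empty, add_zero, ENNReal.ofReal_one, div_one]
  exact ENNReal.mul_lt_top (by simp) h1

/-- The annuli of a family of sets of level `n`, outside a family of sets of level `m`, have large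
volume unless the sets of level `m` have large perimeter. -/
lemma mul_sum_perimeter_le (h : RegularSystem d r C q k S E c B) (hr : ∀ n, 1 ≤ n → 0 < r n)
    {n m : ℕ} (hn : 1 ≤ n) (hnm : n < m) (hk : 0 < k n m) {L L' : Finset Word}
    (hL : L ⊆ words n) (hL' : L' ⊆ words m) (Z : Set (EuclideanSpace ℝ (Fin d)))
    (hZ : volume Z ≠ ⊤)
    (hLZ : ∀ I ∈ L, ∀ j < k n m, ∀ x ∈ annulus (r m) (E I m j),
      x ∈ Z ∨ ∃ J ∈ L', x ∈ S J) :
    r n * ∑ I ∈ L, (perimeter (S I)).toReal ≤ 2 * B * (volume Z).toReal +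
      C * r n / k n m * ∑ J ∈ L', (perimeter (S J)).toReal := by
  classical
  have hrn := hr n hn
  have hrm := hr m (by omega)
  have hkR : (0 : ℝ) < k n m := by exact_mod_cast hk
  set P : Finset (Word × ℕ) := L ×ˢ Finset.range (k n m) with hP
  set D : Word × ℕ → Set (EuclideanSpace ℝ (Fin d)) := fun p =>
    annulus (r m) (E p.1 m p.2) with hD
  -- Only sets meeting the annulus enter Y, so each perimeter (S J) is charged at most C times in
  -- all.
  set T : Word × ℕ → Finset Word := fun p => L'.filter fun J => (D p ∩ S J).Nonempty with hT
  have hPmem : ∀ p ∈ P, p.1 ∈ L ∧ p.1.length = n ∧ p.2 < k n m := by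
    intro p hp
    rw [hP, Finset.mem_product, Finset.mem_range] at hp
    exact ⟨hp.1, mem_words.1 (hL hp.1), hp.2⟩
  have hstep : ∀ p ∈ P, perimeter (S p.1) ≤
      2 * volume (D p ∩ Z) / ENNReal.ofReal (r m) + ∑ J ∈ T p, perimeter (S J) := by
    intro p hp
    obtain ⟨hpL, hpn, hpk⟩ := hPmem p hp
    have h1 := perimeter_le_of_subset hrm (h.subset_E p.1 (by omega) m (by omega) p.2)
      (h.isBounded' p.1 (by omega) m (by omega) p.2)
      (Y := ⋃ J ∈ T p, S J)
      (Finset.measurableSet_biUnion _ fun J _ => (h.isOpen J).measurableSet)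
    refine h1.trans (add_le_add ?_ (perimeter_biUnion_le _ _))
    gcongr
    rintro x ⟨hx, hx'⟩
    refine ⟨hx, (hLZ p.1 hpL p.2 hpk x hx).resolve_right ?_⟩
    rintro ⟨J, hJ, hxJ⟩
    exact hx' (mem_iUnion₂.2 ⟨J, Finset.mem_filter.2 ⟨hJ, x, hx, hxJ⟩, hxJ⟩)
  have hcover : ∑ p ∈ P, volume (D p ∩ Z) ≤
      ENNReal.ofReal (B * (k n m * r m) / r n) * volume Z := by
    refine sum_measure_inter_le volume P (fun p _ =>
      isOpen_thickening.measurableSet.diff (h.isClosed _ _ _).measurableSet) Z fun x => ?_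
    rw [← ENNReal.ofReal_natCast]
    refine ENNReal.ofReal_le_ofReal ?_
    rw [le_div_iff₀ hrn]
    refine le_trans (mul_le_mul_of_nonneg_right (Nat.cast_le.2 (ncard_le_ncard ?_
      (finite_pairs n (k n m) _))) hrn.le) (h.cover n m hn hnm x)
    rintro p ⟨hp, hx⟩
    obtain ⟨-, hpn, hpk⟩ := hPmem p hp
    exact ⟨hpn, hpk, hx⟩
  have hcount : ∑ p ∈ P, ∑ J ∈ T p, perimeter (S J) ≤ C * ∑ J ∈ L', perimeter (S J) := by
    have h1 : ∑ p ∈ P, ∑ J ∈ T p, perimeter (S J) =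
        ∑ J ∈ L', ∑ p ∈ P.filter fun p => (D p ∩ S J).Nonempty, perimeter (S J) := by
      refine Finset.sum_comm' fun p J => ?_
      simp only [hT, Finset.mem_filter]
      tauto
    rw [h1, Finset.mul_sum]
    refine Finset.sum_le_sum fun J hJ => ?_
    rw [Finset.sum_const, nsmul_eq_mul]
    gcongr
    have h2 : ((P.filter fun p => (D p ∩ S J).Nonempty : Finset _) : Set (Word × ℕ)).encard ≤ C := by
      refine le_trans (encard_le_encard ?_) (h.meets n m hn hnm.le J (mem_words.1 (hL' hJ)))
      intro p hp
      rw [Finset.mem_coe, Finset.mem_filter] at hp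
      obtain ⟨-, hpn, hpk⟩ := hPmem p hp.1
      exact ⟨hpn, hpk, hp.2⟩
    rw [encard_coe_eq_coe_finsetCard] at h2
    exact_mod_cast h2
  have htotal : (k n m : ℝ≥0∞) * ∑ I ∈ L, perimeter (S I) ≤
      2 * (ENNReal.ofReal (B * (k n m * r m) / r n) * volume Z) / ENNReal.ofReal (r m) +
        C * ∑ J ∈ L', perimeter (S J) := by
    calc (k n m : ℝ≥0∞) * ∑ I ∈ L, perimeter (S I) = ∑ p ∈ P, perimeter (S p.1) := by
          rw [hP, Finset.sum_product, Finset.mul_sum]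
          simp
      _ ≤ ∑ p ∈ P, (2 * volume (D p ∩ Z) / ENNReal.ofReal (r m) +
            ∑ J ∈ T p, perimeter (S J)) := Finset.sum_le_sum hstep
      _ = 2 * (∑ p ∈ P, volume (D p ∩ Z)) / ENNReal.ofReal (r m) +
            ∑ p ∈ P, ∑ J ∈ T p, perimeter (S J) := by
          rw [Finset.sum_add_distrib, Finset.mul_sum]
          simp only [div_eq_mul_inv, Finset.sum_mul]
      _ ≤ _ := by gcongr
  have hfin : ∀ I ∈ L, perimeter (S I) ≠ ⊤ := fun I hI =>
    (h.perimeter_lt_top (by rw [mem_words.1 (hL hI)]; exact hn)).ne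
  have hfin' : ∀ J ∈ L', perimeter (S J) ≠ ⊤ := fun J hJ =>
    (h.perimeter_lt_top (by rw [mem_words.1 (hL' hJ)]; omega)).ne
  have hr0 : ENNReal.ofReal (r m) ≠ 0 := by simpa using hrm
  have hX : 2 * (ENNReal.ofReal (B * (k n m * r m) / r n) * volume Z) / ENNReal.ofReal (r m) ≠ ⊤ :=
    ENNReal.div_ne_top (ENNReal.mul_ne_top (by simp) (ENNReal.mul_ne_top (by simp) hZ)) hr0
  have hY : (C : ℝ≥0∞) * ∑ J ∈ L', perimeter (S J) ≠ ⊤ :=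
    ENNReal.mul_ne_top (by simp) (ENNReal.sum_ne_top.2 hfin')
  have hreal := ENNReal.toReal_mono (ENNReal.add_ne_top.2 ⟨hX, hY⟩) htotal
  have hB := h.B_nonneg
  rw [ENNReal.toReal_add hX hY, ENNReal.toReal_mul, ENNReal.toReal_mul, ENNReal.toReal_div,
    ENNReal.toReal_mul, ENNReal.toReal_mul, ENNReal.toReal_sum hfin, ENNReal.toReal_sum hfin',
    ENNReal.toReal_ofReal (by positivity), ENNReal.toReal_ofReal hrm.le, ENNReal.toReal_natCast,
    ENNReal.toReal_natCast, ENNReal.toReal_ofNat] at hreal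
  set A := ∑ I ∈ L, (perimeter (S I)).toReal
  set A' := ∑ J ∈ L', (perimeter (S J)).toReal
  set X := (volume Z).toReal
  have h1 : r n / k n m * (k n m * A) ≤
      r n / k n m * (2 * (B * (k n m * r m) / r n * X) / r m + C * A') := by gcongr
  have h2 : r n / k n m * (k n m * A) = r n * A := by field_simp
  have h3 : r n / k n m * (2 * (B * (k n m * r m) / r n * X) / r m + C * A') =
      2 * B * X + C * r n / k n m * A' := by field_simp
  linarith

end RegularSystem

end Systems

/-! ### Monotonicity of the scale sequence -/

section Scales

lemma Disj.of_append {I : Word} {v w : Word} (hlen : v.length = w.length) (hne : v ≠ w) :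
    Disj (I ++ v) (I ++ w) := by
  refine ⟨fun h => hne ?_, fun h => hne ?_⟩
  · exact (List.append_cancel_left (h.eq_of_length (by simp [hlen]))).symm
  · exact List.append_cancel_left (h.eq_of_length (by simp [hlen]))

lemma exists_disj {I : Word} (hI : 1 ≤ I.length) : ∃ K, Disj K I := by
  obtain ⟨b, l, rfl⟩ : ∃ b l, I = b :: l := List.exists_cons_of_length_pos hI
  refine ⟨[!b], ?_, ?_⟩ <;> simp [Inside, List.cons_prefix_cons]

variable {ρ : Word → Word → ℝ} {r : ℕ → ℝ}

lemma IsScaleSequence.nonneg (hρ : IsDistanceFunction ρ) (hr : IsScaleSequence ρ r) {n : ℕ}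
    (hn : 1 ≤ n) : 0 ≤ r n := by
  have h := (hr n hn (List.replicate n true) (by simp)).1 ⟨_, List.prefix_refl _, rfl⟩
  refine le_trans (Real.sInf_nonneg ?_) h
  rintro t ⟨K, -, rfl⟩
  exact hρ.nonneg _ _

/-- Lengthening I leaves fewer J for the supremum and admits more K in the infimum. -/
lemma IsScaleSequence.succ_le (hρ : IsDistanceFunction ρ) (hr : IsScaleSequence ρ r) {n : ℕ}
    (hn : 1 ≤ n) : r (n + 1) ≤ r n := by
  set I : Word := List.replicate n true with hI
  have hIlen : I.length = n := by simp [hI]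
  refine (hr (n + 1) (by omega) (I ++ [true]) (by simp [hIlen])).2 ?_
  rintro t ⟨J, hJ, rfl⟩
  have hJI : Inside J I := (List.prefix_append I [true]).trans hJ
  refine le_trans ?_ ((hr n hn I hIlen).1 ⟨J, hJI, rfl⟩)
  refine csInf_le_csInf ⟨0, ?_⟩ ?_ ?_
  · rintro t ⟨K, -, rfl⟩
    exact hρ.nonneg _ _
  · obtain ⟨K, hK⟩ := exists_disj (I := I) (by omega)
    exact ⟨_, K, hK, rfl⟩
  · rintro t ⟨K, hK, rfl⟩
    refine ⟨K, ⟨fun h => ?_, fun h => ?_⟩, rfl⟩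
    · exact hK.1 ((List.prefix_append I [true]).trans h)
    · exact (List.prefix_or_prefix_of_prefix h (List.prefix_append I [true])).elim hK.2 hK.1

end Scales

/-! ### Least volumes and gaps -/

namespace RegularSystem

variable {d : ℕ} {r : ℕ → ℝ} {C q : ℕ} {k : ℕ → ℕ → ℕ}
  {S : Word → Set (EuclideanSpace ℝ (Fin d))}
  {E : Word → ℕ → ℕ → Set (EuclideanSpace ℝ (Fin d))} {c B : ℝ}

lemma volume_ne_top (h : RegularSystem d r C q k S E c B) {I : Word} (hI : 1 ≤ I.length) :
    volume (S I) ≠ ⊤ := (h.isBounded I hI).measure_lt_top.ne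

/-- The part of `S I` outside the sets of level `m`. -/
def gap (S : Word → Set (EuclideanSpace ℝ (Fin d))) (I : Word) (m : ℕ) :
    Set (EuclideanSpace ℝ (Fin d)) :=
  S I \ ⋃ J ∈ words m, S J

lemma exists_minimizer (S : Word → Set (EuclideanSpace ℝ (Fin d))) (n : ℕ) :
    ∃ I : Word, I.length = n ∧ ∀ J : Word, J.length = n →
      (volume (S I)).toReal ≤ (volume (S J)).toReal := by
  obtain ⟨I, hI, hmin⟩ := (words n).exists_min_image (fun I => (volume (S I)).toReal)
    ⟨List.replicate n true, by simp⟩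
  exact ⟨I, mem_words.1 hI, fun J hJ => hmin J (mem_words.2 hJ)⟩

/-- A sequence of length `n` for which `S I` has the least volume. -/
noncomputable def minimizer (S : Word → Set (EuclideanSpace ℝ (Fin d))) (n : ℕ) : Word :=
  (exists_minimizer S n).choose

lemma length_minimizer (S : Word → Set (EuclideanSpace ℝ (Fin d))) (n : ℕ) :
    (minimizer S n).length = n := (exists_minimizer S n).choose_spec.1

/-- The least volume of the sets of level `n`, multiplied by their number. -/
noncomputable def minVolume (S : Word → Set (EuclideanSpace ℝ (Fin d))) (n : ℕ) : ℝ :=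
  2 ^ n * (volume (S (minimizer S n))).toReal

lemma minVolume_nonneg (S : Word → Set (EuclideanSpace ℝ (Fin d))) (n : ℕ) :
    0 ≤ minVolume S n := by
  unfold minVolume
  positivity

lemma minVolume_le {n : ℕ} {J : Word} (hJ : J.length = n) :
    minVolume S n ≤ 2 ^ n * (volume (S J)).toReal :=
  mul_le_mul_of_nonneg_left ((exists_minimizer S n).choose_spec.2 J hJ) (by positivity)

/-- The minimiser contains 2 ^ (m - n) disjoint sets of level m, each of volume at least minVolume S
m / 2 ^ m. -/
lemma volume_gap_le (h : RegularSystem d r C q k S E c B) {n m : ℕ} (hn : 1 ≤ n) (hnm : n ≤ m) :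
    2 ^ n * (volume (gap S (minimizer S n) m)).toReal ≤ minVolume S n - minVolume S m := by
  set I := minimizer S n with hI
  have hIlen : I.length = n := length_minimizer S n
  set J : (Fin (m - n) → Bool) → Word := fun w => I ++ List.ofFn w with hJ
  have hJlen : ∀ w, (J w).length = m := fun w => by
    simp only [hJ, List.length_append, List.length_ofFn]; omega
  have hdisj : Pairwise (Function.onFun Disjoint fun w => S (J w)) := fun v w hvw =>
    h.disjoint _ _ (by rw [hJlen]; omega) (by rw [hJlen]; omega)
      (Disj.of_append (by simp) fun h' => hvw (List.ofFn_injective h'))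
  have hgap : Disjoint (gap S I m) (⋃ w, S (J w)) := by
    rw [disjoint_left]
    rintro x ⟨-, hx⟩ hx'
    obtain ⟨w, hw⟩ := mem_iUnion.1 hx'
    exact hx (mem_iUnion₂.2 ⟨J w, mem_words.2 (hJlen w), hw⟩)
  have hmeas : MeasurableSet (⋃ w, S (J w)) :=
    MeasurableSet.iUnion fun w => (h.isOpen _).measurableSet
  have hsub : gap S I m ∪ ⋃ w, S (J w) ⊆ S I :=
    union_subset sdiff_subset (iUnion_subset fun w =>
      h.subset I (J w) (by omega) (List.prefix_append I _))
  have hfinI := h.volume_ne_top (I := I) (by omega)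
  have hfinJ : ∀ w, volume (S (J w)) ≠ ⊤ := fun w => h.volume_ne_top (by rw [hJlen]; omega)
  have hfinG : volume (gap S I m) ≠ ⊤ :=
    ((measure_mono sdiff_subset).trans_lt hfinI.lt_top).ne
  have h1 : volume (gap S I m) + ∑ w, volume (S (J w)) ≤ volume (S I) := by
    have h2 := measure_iUnion (μ := volume) hdisj fun w => (h.isOpen (J w)).measurableSet
    rw [tsum_fintype] at h2
    rw [← h2, ← measure_union hgap hmeas]
    exact measure_mono hsub
  have h3 := ENNReal.toReal_mono hfinI h1
  rw [ENNReal.toReal_add hfinG (ENNReal.sum_ne_top.2 fun w _ => hfinJ w),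
    ENNReal.toReal_sum fun w _ => hfinJ w] at h3
  have h4 : minVolume S m ≤ 2 ^ n * ∑ w, (volume (S (J w))).toReal := by
    have h5 : ∑ _w : Fin (m - n) → Bool, minVolume S m ≤
        ∑ w, 2 ^ m * (volume (S (J w))).toReal :=
      Finset.sum_le_sum fun w _ => minVolume_le (hJlen w)
    have h6 : (2 : ℝ) ^ m = 2 ^ n * 2 ^ (m - n) := by rw [← pow_add]; congr 1; omega
    rw [← Finset.mul_sum, Finset.sum_const, Finset.card_univ, Fintype.card_fun, Fintype.card_bool,
      Fintype.card_fin, nsmul_eq_mul, h6, mul_comm ((2 : ℝ) ^ n), mul_assoc] at h5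
    push_cast at h5
    exact le_of_mul_le_mul_left h5 (by positivity)
  have h7 : minVolume S n = 2 ^ n * (volume (S I)).toReal := rfl
  have h8 : (2 : ℝ) ^ n * ((volume (gap S I m)).toReal + ∑ w, (volume (S (J w))).toReal) ≤
      2 ^ n * (volume (S I)).toReal := by gcongr
  rw [h7]
  linarith

lemma minVolume_anti (h : RegularSystem d r C q k S E c B) {n m : ℕ} (hn : 1 ≤ n)
    (hnm : n ≤ m) : minVolume S m ≤ minVolume S n := by
  have := h.volume_gap_le hn hnm
  have h0 : (0 : ℝ) ≤ 2 ^ n * (volume (gap S (minimizer S n) m)).toReal := by positivity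
  linarith

end RegularSystem

/-! ### Relative scales -/

lemma two_rpow_pow {d : ℕ} (hd : 1 ≤ d) (n : ℕ) : ((2 : ℝ) ^ ((n : ℝ) / d)) ^ d = 2 ^ n := by
  have : (d : ℝ) ≠ 0 := by positivity
  rw [← Real.rpow_natCast, ← Real.rpow_mul (by norm_num), div_mul_cancel₀ _ this,
    Real.rpow_natCast]

/-- The scale `r n` relative to the side length of `2 ^ n` cubes of total volume one. -/
noncomputable def relScale (d : ℕ) (r : ℕ → ℝ) (n : ℕ) : ℝ := 2 ^ ((n : ℝ) / d) * r n

lemma relScale_succ_le {d : ℕ} (hd : 1 ≤ d) {r : ℕ → ℝ} {n : ℕ} (h0 : 0 ≤ r (n + 1))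
    (h : r (n + 1) ≤ r n) : relScale d r (n + 1) ≤ 2 * relScale d r n := by
  have hdR : (1 : ℝ) ≤ d := by exact_mod_cast hd
  have h1 : (2 : ℝ) ^ (((n + 1 : ℕ) : ℝ) / d) ≤ 2 * 2 ^ ((n : ℝ) / d) := by
    rw [← Real.rpow_one_add' (by norm_num) (by positivity)]
    refine Real.rpow_le_rpow_of_exponent_le (by norm_num) ?_
    push_cast
    rw [add_div, add_comm]
    gcongr
    exact (div_le_one (by linarith)).2 hdR
  unfold relScale
  calc (2 : ℝ) ^ (((n + 1 : ℕ) : ℝ) / d) * r (n + 1) ≤ 2 * 2 ^ ((n : ℝ) / d) * r n := by gcongr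
    _ = _ := by ring

namespace RegularSystem

variable {d : ℕ} {r : ℕ → ℝ} {C q : ℕ} {k : ℕ → ℕ → ℕ}
  {S : Word → Set (EuclideanSpace ℝ (Fin d))}
  {E : Word → ℕ → ℕ → Set (EuclideanSpace ℝ (Fin d))} {c B : ℝ}

/-- The ball of radius c * r n inside the minimiser bounds its volume below; ω is the volume of the
unit ball. -/
lemma exists_mul_relScale_le (h : RegularSystem d r C q k S E c B) (hd : 1 ≤ d)
    (hr : ∀ n, 1 ≤ n → 0 < r n) :
    ∃ a : ℝ, 0 < a ∧ ∀ n, 1 ≤ n → a * relScale d r n ≤ minVolume S n ^ (1 / (d : ℝ)) := by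
  have hdR : (d : ℝ) ≠ 0 := by positivity
  set ω := (volume (ball (0 : EuclideanSpace ℝ (Fin d)) 1)).toReal with hω
  have hω0 : 0 < ω := ENNReal.toReal_pos (measure_ball_pos _ _ one_pos).ne' measure_ball_lt_top.ne
  have hc := h.c_pos
  refine ⟨c * ω ^ (1 / (d : ℝ)), by positivity, fun n hn => ?_⟩
  have hrn := hr n hn
  have hlen : (minimizer S n).length = n := length_minimizer S n
  obtain ⟨x, hx⟩ := h.ball_subset (minimizer S n) (by omega)
  rw [hlen] at hx
  have h1 := ENNReal.toReal_mono (h.volume_ne_top (I := minimizer S n) (by omega))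
    (measure_mono (μ := volume) hx)
  rw [Measure.addHaar_ball_of_pos _ _ (by positivity), ENNReal.toReal_mul,
    ENNReal.toReal_ofReal (by positivity), finrank_euclideanSpace_fin] at h1
  have h2 : (c * ω ^ (1 / (d : ℝ)) * relScale d r n) ^ d ≤ minVolume S n := by
    have h3 : (ω ^ (1 / (d : ℝ))) ^ d = ω := by
      rw [← Real.rpow_natCast, ← Real.rpow_mul hω0.le, one_div_mul_cancel hdR, Real.rpow_one]
    calc (c * ω ^ (1 / (d : ℝ)) * relScale d r n) ^ d
        = 2 ^ n * ((c * r n) ^ d * ω) := by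
          rw [relScale, mul_pow, mul_pow, mul_pow, mul_pow, two_rpow_pow hd, h3]; ring
      _ ≤ minVolume S n := by
          exact mul_le_mul_of_nonneg_left h1 (by positivity)
  have h4 : 0 ≤ c * ω ^ (1 / (d : ℝ)) * relScale d r n := by
    unfold relScale; positivity
  rw [one_div (d : ℝ)] at h2 h4 ⊢
  rw [Real.le_rpow_inv_iff_of_pos h4 (minVolume_nonneg S n) (by positivity), Real.rpow_natCast]
  exact h2

end RegularSystem

/-! ### The recursion for total perimeters -/

namespace RegularSystem

variable {d : ℕ} {r : ℕ → ℝ} {C q : ℕ} {k : ℕ → ℕ → ℕ}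
  {S : Word → Set (EuclideanSpace ℝ (Fin d))}
  {E : Word → ℕ → ℕ → Set (EuclideanSpace ℝ (Fin d))} {c B : ℝ}

lemma nonempty (h : RegularSystem d r C q k S E c B) (hr : ∀ n, 1 ≤ n → 0 < r n) {I : Word}
    (hI : 1 ≤ I.length) : (S I).Nonempty := by
  obtain ⟨x, hx⟩ := h.ball_subset I hI
  exact ⟨x, hx (mem_ball_self (mul_pos h.c_pos (hr _ hI)))⟩

/-- Isoperimetry together with the splitting of 2 ^ n as (2 ^ n) ^ (1 - 1/d) times 2 ^ (n/d). -/
lemma le_perimeter (h : RegularSystem d r C q k S E c B) (hd : 1 ≤ d)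
    (hr : ∀ n, 1 ≤ n → 0 < r n) {n : ℕ} (hn : 1 ≤ n) {I : Word} (hI : I.length = n) :
    (minVolume S n ^ (1 / (d : ℝ))) ^ (d - 1) * 2 ^ ((n : ℝ) / d) ≤
      2 ^ n * (perimeter (S I)).toReal := by
  have hdR : (0 : ℝ) < d := by exact_mod_cast hd
  have hexp : (0 : ℝ) ≤ 1 - 1 / (d : ℝ) := by
    rw [sub_nonneg, div_le_one hdR]
    exact_mod_cast hd
  have h1 := ENNReal.toReal_mono (h.perimeter_lt_top (I := I) (by omega)).ne
    (perimeter_ge hd (h.nonempty hr (I := I) (by omega)))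
  rw [← ENNReal.toReal_rpow] at h1
  have hv := minVolume_nonneg S n
  have h2 : (minVolume S n ^ (1 / (d : ℝ))) ^ (d - 1) = minVolume S n ^ (1 - 1 / (d : ℝ)) := by
    rw [← Real.rpow_natCast, ← Real.rpow_mul hv, Nat.cast_sub hd]
    congr 1
    push_cast
    field_simp
  have h3 : minVolume S n ^ (1 - 1 / (d : ℝ)) ≤
      (2 ^ n) ^ (1 - 1 / (d : ℝ)) * (volume (S I)).toReal ^ (1 - 1 / (d : ℝ)) := by
    rw [← Real.mul_rpow (by positivity) ENNReal.toReal_nonneg]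
    exact Real.rpow_le_rpow hv (minVolume_le hI) hexp
  have h4 : ((2 : ℝ) ^ n) ^ (1 - 1 / (d : ℝ)) * 2 ^ ((n : ℝ) / d) = 2 ^ n := by
    rw [← Real.rpow_natCast, ← Real.rpow_mul (by norm_num), ← Real.rpow_add (by norm_num)]
    congr 1
    field_simp
    ring
  rw [h2]
  calc minVolume S n ^ (1 - 1 / (d : ℝ)) * 2 ^ ((n : ℝ) / d)
      ≤ ((2 ^ n) ^ (1 - 1 / (d : ℝ)) * (volume (S I)).toReal ^ (1 - 1 / (d : ℝ))) *
        2 ^ ((n : ℝ) / d) := by gcongr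
    _ = ((2 ^ n) ^ (1 - 1 / (d : ℝ)) * 2 ^ ((n : ℝ) / d)) *
        (volume (S I)).toReal ^ (1 - 1 / (d : ℝ)) := mul_right_comm _ _ _
    _ = 2 ^ n * (volume (S I)).toReal ^ (1 - 1 / (d : ℝ)) := by rw [h4]
    _ ≤ _ := by gcongr

lemma exists_recursion (h : RegularSystem d r C q k S E c B) (hd : 1 ≤ d)
    (hr : ∀ n, 1 ≤ n → 0 < r n) (hk : ∀ n m, 1 ≤ n → n ≤ m → 0 < k n m) {l : ℕ} (hql : q ≤ l)
    (hl : 1 ≤ l) {k₀ : ℕ} (hk₀ : 1 ≤ k₀) :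
    ∃ (H : ℕ → ℝ) (K : ℝ), (∀ n, 0 ≤ H n) ∧ (∀ n, k₀ + q ≤ n → H n ≤ K) ∧
      (2 ^ q)⁻¹ * relScale d r (k₀ + q) * (minVolume S (k₀ + q) ^ (1 / (d : ℝ))) ^ (d - 1) ≤
        H (k₀ + q) ∧
      ∀ n m, k₀ + q ≤ n → n + l ≤ m →
        H n ≤ 2 * B * ((minVolume S k₀ ^ (1 / (d : ℝ))) ^ d -
            (minVolume S m ^ (1 / (d : ℝ))) ^ d) +
          C * (2 ^ (((m : ℝ) - n) / d) * (k n m : ℝ)⁻¹) * (relScale d r n / relScale d r m) *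
            H m := by
  classical
  set I := minimizer S k₀ with hI
  have hIlen : I.length = k₀ := length_minimizer S k₀
  have hI1 : 1 ≤ I.length := by omega
  obtain ⟨F, hF1, hF2⟩ := h.family I hI1
  rw [hIlen] at hF1 hF2
  set L : ℕ → Finset Word := fun n => (words n).filter (· ∈ F n) with hL
  have hLmem : ∀ n J, J ∈ L n ↔ J.length = n ∧ J ∈ F n := fun n J => by simp [hL]
  have hLw : ∀ n, L n ⊆ words n := fun n => Finset.filter_subset _ _
  set A : ℕ → ℝ := fun n => ∑ J ∈ L n, (perimeter (S J)).toReal with hA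
  have hA0 : ∀ n, 0 ≤ A n := fun n => Finset.sum_nonneg fun _ _ => ENNReal.toReal_nonneg
  have hpow : ∀ n, (minVolume S n ^ (1 / (d : ℝ))) ^ d = minVolume S n := fun n => by
    rw [one_div]
    exact Real.rpow_inv_natCast_pow (minVolume_nonneg S n) (by omega)
  have hfinI := h.volume_ne_top hI1
  -- The maximum keeps H nonnegative at n = 0, where r is unconstrained. The bound K comes from the
  -- perimeter inequality with Z = S I and no sets of level m.
  refine ⟨fun n => 2 ^ k₀ * (max (r n) 0 * A n), 2 ^ k₀ * (2 * B * (volume (S I)).toReal),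
    fun n => by have := hA0 n; positivity, fun n hn => ?_, ?_, fun n m hn hm => ?_⟩
  · have h1 := h.mul_sum_perimeter_le hr (n := n) (m := n + l) (by omega) (by omega)
      (hk _ _ (by omega) (by omega)) (hLw n) (Finset.empty_subset _) (S I) hfinI
      fun J hJ j hj x hx => Or.inl ((hF2 n (n + l) hn (by omega) J ((hLmem n J).1 hJ).2 j hj).1 hx)
    rw [Finset.sum_empty, mul_zero, add_zero] at h1
    have hrn := (hr n (by omega)).le
    simp only
    rw [max_eq_left hrn]
    gcongr
  -- One member of the family suffices; 2 ^ (-q) appears because H carries the weight of level k₀,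
  -- not k₀ + q.
  · have hrn := (hr (k₀ + q) (by omega)).le
    obtain ⟨⟨J, hJ⟩, hJlen⟩ := hF1 (k₀ + q) le_rfl
    have hJ1 : J.length = k₀ + q := (hJlen J hJ).1
    have h1 : (perimeter (S J)).toReal ≤ A (k₀ + q) :=
      Finset.single_le_sum (f := fun J => (perimeter (S J)).toReal)
        (fun _ _ => ENNReal.toReal_nonneg) ((hLmem _ J).2 ⟨hJ1, hJ⟩)
    have h2 := h.le_perimeter hd hr (by omega) hJ1
    simp only
    rw [max_eq_left hrn, relScale]
    set y := (minVolume S (k₀ + q) ^ (1 / (d : ℝ))) ^ (d - 1)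
    calc (2 ^ q)⁻¹ * (2 ^ (((k₀ + q : ℕ) : ℝ) / d) * r (k₀ + q)) * y
        = (2 ^ q)⁻¹ * r (k₀ + q) * (y * 2 ^ (((k₀ + q : ℕ) : ℝ) / d)) := by ring
      _ ≤ (2 ^ q)⁻¹ * r (k₀ + q) * (2 ^ (k₀ + q) * (perimeter (S J)).toReal) := by gcongr
      _ = 2 ^ k₀ * (r (k₀ + q) * (perimeter (S J)).toReal) := by
          rw [pow_add]; field_simp
      _ ≤ _ := by gcongr
  · have hrn := hr n (by omega)
    have hrm := hr m (by omega)
    have hknm := hk n m (by omega) (by omega)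
    have hkR : (0 : ℝ) < k n m := by exact_mod_cast hknm
    have hgapfin : volume (gap S I m) ≠ ⊤ :=
      ((measure_mono sdiff_subset).trans_lt hfinI.lt_top).ne
    -- A point of an annulus lies in the gap or in some set of level m, which then belongs to the
    -- family F m.
    have h1 := h.mul_sum_perimeter_le hr (n := n) (m := m) (by omega) (by omega)
      hknm (hLw n) (hLw m) (gap S I m) hgapfin
      fun J hJ j hj x hx => by
        obtain ⟨h2, h3⟩ := hF2 n m hn (by omega) J ((hLmem n J).1 hJ).2 j hj
        by_cases hxm : x ∈ ⋃ J ∈ words m, S J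
        · obtain ⟨J', hJ', hxJ'⟩ := mem_iUnion₂.1 hxm
          have hJ'len := mem_words.1 hJ'
          exact Or.inr ⟨J', (hLmem m J').2 ⟨hJ'len, h3 J' hJ'len ⟨x, hx, hxJ'⟩⟩, hxJ'⟩
        · exact Or.inl ⟨h2 hx, hxm⟩
    have h2 := h.volume_gap_le hk₀ (show k₀ ≤ m by omega)
    have hB := h.B_nonneg
    have h3 : 2 * B * (2 ^ k₀ * (volume (gap S I m)).toReal) ≤
        2 * B * (minVolume S k₀ - minVolume S m) := by gcongr
    have hm2 : (2 : ℝ) ^ ((m : ℝ) / d) = 2 ^ (((m : ℝ) - n) / d) * 2 ^ ((n : ℝ) / d) := by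
      rw [← Real.rpow_add (by norm_num)]
      congr 1
      ring
    have h4 : C * (2 ^ (((m : ℝ) - n) / d) * (k n m : ℝ)⁻¹) * (relScale d r n / relScale d r m) *
        (2 ^ k₀ * (r m * A m)) = 2 ^ k₀ * (C * r n / k n m * A m) := by
      rw [relScale, relScale, hm2]
      field_simp
    simp only
    rw [hpow, hpow, max_eq_left hrn.le, max_eq_left hrm.le, h4]
    calc (2 : ℝ) ^ k₀ * (r n * A n)
        ≤ 2 ^ k₀ * (2 * B * (volume (gap S I m)).toReal + C * r n / k n m * A m) := by gcongr
      _ = 2 * B * (2 ^ k₀ * (volume (gap S I m)).toReal) + 2 ^ k₀ * (C * r n / k n m * A m) := by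
          ring
      _ ≤ _ := by gcongr

lemma summable_relScale (h : RegularSystem d r C q k S E c B) (hd : 1 ≤ d) (hC : 0 < C)
    (hk : AdmissibleCounts d r C k) (hr : ∀ n, 1 ≤ n → 0 < r n)
    (hanti : ∀ n, 1 ≤ n → r (n + 1) ≤ r n) : Summable fun n => relScale d r (n + 1) := by
  obtain ⟨a, ha, hay⟩ := h.exists_mul_relScale_le hd hr
  obtain ⟨b, hb⟩ := hk.sum
  obtain ⟨l, hl⟩ := hk.large
  have hCR : (0 : ℝ) < C := by exact_mod_cast hC
  -- The level difference is raised to at least q for the family condition, and to at least 1 so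
  -- that m > n.
  refine summable_of_recursion (d := d) hd q (max l (max q 1)) (B := C * max b 0)
    (γ := (2 ^ q)⁻¹) (c := a) (K₁ := 2 * B)
    (y := fun n => minVolume S n ^ (1 / (d : ℝ)))
    (e := fun n m => C * (2 ^ (((m : ℝ) - n) / d) * (k n m : ℝ)⁻¹))
    (by positivity) (by positivity) ha (by have := h.B_nonneg; positivity) ?_ ?_ hay ?_ ?_ ?_ ?_ ?_
  · intro n hn
    have := hr n hn
    unfold relScale
    positivity
  · exact fun n hn => relScale_succ_le hd (hr (n + 1) (by omega)).le (hanti n hn)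
  · exact fun n m hn hnm =>
      Real.rpow_le_rpow (minVolume_nonneg S m) (h.minVolume_anti hn hnm) (by positivity)
  · intro n m _ _
    positivity
  · intro n M hn
    rw [← Finset.mul_sum]
    gcongr
    exact (hb n hn M).trans (le_max_left _ _)
  · intro n m hn hm
    have h1 := (hl n m hn (by omega)).le
    calc (C : ℝ) * (2 ^ (((m : ℝ) - n) / d) * (k n m : ℝ)⁻¹) ≤ C * (4 * (C : ℝ))⁻¹ := by gcongr
      _ = 1 / 4 := by field_simp
  · exact fun k₀ hk₀ => h.exists_recursion hd hr hk.pos (by omega) (by omega) hk₀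

end RegularSystem

end BinaryEmbedding

theorem mainTheorem3 (d : ℕ) (hd : 1 ≤ d)
    (ρ : BinaryEmbedding.Word → BinaryEmbedding.Word → ℝ)
    (hρ : BinaryEmbedding.IsDistanceFunction ρ)
    (r : ℕ → ℝ) (hr : BinaryEmbedding.IsScaleSequence ρ r)
    (hgrowth : BinaryEmbedding.BoundedGrowth d ρ r)
    (hpos : BinaryEmbedding.PositiveAnswer d ρ) :
    Summable (fun n : ℕ => (2 : ℝ) ^ (((n + 1 : ℕ) : ℝ) / (d : ℝ)) * r (n + 1)) := by
  have hanti : ∀ n, 1 ≤ n → r (n + 1) ≤ r n := fun n hn => hr.succ_le hρ hn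
  by_cases h0 : ∀ n, 1 ≤ n → 0 < r n
  · obtain ⟨C, q, k, hC, hk, hsys⟩ := hgrowth hpos
    obtain ⟨S, E, c, B, hreg⟩ := hsys.exists_regularSystem h0
    exact hreg.summable_relScale hd hC hk h0 hanti
  -- If some r n vanishes, monotonicity makes all later terms zero.
  · push Not at h0
    obtain ⟨n, hn, hn0⟩ := h0
    have hzero : ∀ j, r (n + j) = 0 := by
      intro j
      refine le_antisymm ?_ (hr.nonneg hρ (by omega))
      induction j with
      | zero => exact hn0
      | succ j ih => exact (hanti (n + j) (by omega)).trans ih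
    refine summable_of_ne_finset_zero (s := Finset.range n) fun m hm => ?_
    rw [Finset.mem_range, not_lt] at hm
    obtain ⟨j, rfl⟩ := Nat.exists_eq_add_of_le hm
    rw [add_assoc, hzero, mul_zero]
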